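/- \textbf{Setting.} Let $d\ge 1$ and let $\Omega\subset\mathbb R^d$ be a bounded, connected, non-empty open set with Lipschitz boundary (near each boundary point, after a rigid motion, $\Omega$ is the set of points lying strictly above the graph of a Lipschitz function; for $d=1$, $\Omega$ is a bounded open interval). All functions are complex-valued and $\sigma$ is the surface measure on $\partial\Omega$ (counting measure if $d=1$). For $u\in H^1(\Omega)$ with distributional Laplacian $\Delta u\in L^2(\Omega)$, we say that the outer normal derivative $\frac{\partial u}{\partial\nu}$ exists in $L^2(\partial\Omega)$ and equals $h\in L^2(\partial\Omega)$ if $$\int_\Omega \nabla u\cdot\overline{\nabla v}+\Delta u\,\overline v\,dx=\int_{\partial\Omega}h\,\overline v\,d\sigma\qquad\text{for all }v\in H^1(\Omega),$$ where $v$ on $\partial\Omega$ is understood in the sense of traces. For $\beta\in C(\partial\Omega)$, the domain of the Robin Laplacian on $C(\overline\Omega)$ is $$D(\Delta^\beta_\Omega)=\Bigl\{u\in H^1(\Omega)\cap C(\overline\Omega):\ \Delta u\in L^2(\Omega)\cap C(\overline\Omega),\ \tfrac{\partial u}{\partial\nu}\text{ exists in }L^2(\partial\Omega)\text{ and equals }-\beta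 u\Bigr\},$$ and $\Delta^\beta_\Omega u=\Delta u$; for $\beta=0$ this is the Neumann Laplacian. \textbf{Theorem.} Let $\Omega_1,\Omega_2$ be bounded, connected Lipschitz domains in $\mathbb R^d$ if $d\ge 2$, or bounded non-empty open intervals if $d=1$. Let $U:C(\overline\Omega_1)\to C(\overline\Omega_2)$ be a bounded linear operator such that \begin{enumerate} \item[(a)] $f\cdot g=0$ implies $(Uf)\cdot(Ug)=0$ for all $f,g\in C(\overline\Omega_1)$; \item[(b)] there is $\beta\in C(\partial\Omega_2)$ with $U(C_c^\infty(\Omega_1))\subset D(\Delta^\beta_{\Omega_2})$, and $U(\Delta f)=\Delta(Uf)$ on $\Omega_2$ (in the sense of distributions) for all $f\in C_c^\infty(\Omega_1)$; \item[(c)] if $\omega\subset\Omega_2$ is open and $(Uf)|_\omega=0$ for all $f\in C_c^\infty(\Omega_1)$, then $\omega=\emptyset$. \end{enumerate} Then there exist a constant $c\in\mathbb C\setminus\{0\}$, an integer $n\ge1$, pairwise disjoint, connected open sets $\omega_1,\dots,\omega_n\subset\Omega_2$ and isometries $\bar\tau_1,\dots,\bar\tau_n:\mathbb R^d\to\mathbb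 R^d$ such that $\bar\tau_i(\omega_i)=\Omega_1$ for all $i$, $\bigcup_{i=1}^n\omega_i$ is dense in $\Omega_2$, and $$Uf(y)=c\,f(\bar\tau_i(y))\qquad\text{for all }f\in C(\overline\Omega_1),\ y\in\overline{\omega}_i,\ i=1,\dots,n.$$ -/

import Mathlib

open MeasureTheory Set Filter Topology TopologicalSpace
open scoped Distributions

noncomputable section

namespace RobinIntertwining

/-- `ℝᵈ` with the Euclidean norm. -/
abbrev Euc (d : ℕ) : Type := EuclideanSpace ℝ (Fin d)

variable {d : ℕ}

/-- `Ω` has Lipschitz boundary: near every boundary point `z` there are a unit vector `e` and a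
Lipschitz function `g` on the hyperplane `eᗮ` such that `Ω` is, in a neighbourhood of `z`, the set
of points lying strictly above the graph of `g` in the direction `e`. For `d = 1` the hyperplane is
a point and `Ω` is locally an open half-line. -/
def HasLipschitzBoundary (Ω : Set (Euc d)) : Prop :=
  ∀ z ∈ frontier Ω, ∃ e : Euc d, ‖e‖ = 1 ∧
    ∃ (K : NNReal) (g : (Submodule.span ℝ {e})ᗮ → ℝ), LipschitzWith K g ∧
      ∀ᶠ x in 𝓝 z, x ∈ Ω ↔ g ((Submodule.span ℝ {e})ᗮ.orthogonalProjectionOnto x) < inner ℝ e x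

/-- A bounded, connected (in particular non-empty) open set with Lipschitz boundary.
For `d = 1` these are exactly the bounded non-empty open intervals. -/
structure IsLipschitzDomain (Ω : Opens (Euc d)) : Prop where
  isBounded : Bornology.IsBounded (Ω : Set (Euc d))
  isConnected : IsConnected (Ω : Set (Euc d))
  hasLipschitzBoundary : HasLipschitzBoundary (Ω : Set (Euc d))

/-- Surface measure on `∂Ω`: the `(d-1)`-dimensional Hausdorff measure (with the normalisation that
agrees with Lebesgue measure on hyperplanes), restricted to `∂Ω`. For `d = 1` it is the counting
measure on `∂Ω`. -/
def surfaceMeasure (Ω : Opens (Euc d)) : Measure (Euc d) :=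
  (μHE[d - 1] : Measure (Euc d)).restrict (frontier (Ω : Set (Euc d)))

/-- Extension by zero to all of `ℝᵈ` of a continuous function on a subset. All integrals below only
see the values on that subset. -/
def zeroExt {S : Set (Euc d)} (u : C(S, ℂ)) : Euc d → ℂ :=
  Function.extend Subtype.val u 0

/-- Restriction of a continuous function on `ℝᵈ` to the closure of `Ω`. -/
def restrictClosure (Ω : Opens (Euc d)) (f : Euc d → ℂ) (hf : Continuous f) :
    C(closure (Ω : Set (Euc d)), ℂ) :=
  ⟨fun x => f x, hf.comp continuous_subtype_val⟩

theorem continuous_laplacian {Ω : Opens (Euc d)} (φ : 𝓓(Ω, ℂ)) :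
    Continuous (Laplacian.laplacian (φ : Euc d → ℂ)) := by
  rw [InnerProductSpace.laplacian_eq_iteratedFDeriv_stdOrthonormalBasis]
  have h : Continuous (iteratedFDeriv ℝ 2 (φ : Euc d → ℂ)) :=
    φ.contDiff.continuous_iteratedFDeriv (by exact WithTop.coe_le_coe.2 le_top)
  exact continuous_finsetSum _ fun i _ => by fun_prop

/-- A test function, as an element of `C(Ω̄)`. -/
def testFun {Ω : Opens (Euc d)} (φ : 𝓓(Ω, ℂ)) : C(closure (Ω : Set (Euc d)), ℂ) :=
  restrictClosure Ω φ φ.continuous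

/-- The (classical) Laplacian of a test function, as an element of `C(Ω̄)`. -/
def testLaplacian {Ω : Opens (Euc d)} (φ : 𝓓(Ω, ℂ)) : C(closure (Ω : Set (Euc d)), ℂ) :=
  restrictClosure Ω (Laplacian.laplacian (φ : Euc d → ℂ)) (continuous_laplacian φ)

/-- The classical partial derivative `∂ⱼ f`. -/
def partialDeriv (j : Fin d) (f : Euc d → ℂ) (x : Euc d) : ℂ :=
  fderiv ℝ f x (EuclideanSpace.single j 1)

/-- `u ∈ H¹(Ω)` with distributional gradient `G = (G₁, …, G_d)`: the functions `u` and `Gⱼ` are in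
`L²(Ω)` and `∂ⱼ u = Gⱼ` in the sense of distributions on `Ω`. -/
def IsH1With (Ω : Opens (Euc d)) (u : Euc d → ℂ) (G : Fin d → Euc d → ℂ) : Prop :=
  MemLp u 2 (volume.restrict (Ω : Set (Euc d))) ∧
  ∀ j, MemLp (G j) 2 (volume.restrict (Ω : Set (Euc d))) ∧
    ∀ φ : 𝓓(Ω, ℂ), ∫ x in (Ω : Set (Euc d)), u x * partialDeriv j φ x
      = - ∫ x in (Ω : Set (Euc d)), G j x * φ x

/-- `Δ u = w` in the sense of distributions on `Ω` (used for `u` and `w` in `L²(Ω)`). -/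
def HasWeakLaplacian (Ω : Opens (Euc d)) (u w : Euc d → ℂ) : Prop :=
  ∀ φ : 𝓓(Ω, ℂ), ∫ x in (Ω : Set (Euc d)), u x * Laplacian.laplacian (φ : Euc d → ℂ) x
    = ∫ x in (Ω : Set (Euc d)), w x * φ x

/-- `t` is the trace on `∂Ω` of the function `v ∈ H¹(Ω)` with distributional gradient `G`: some
sequence in `C_c^∞(ℝᵈ)` converges to `v` in `H¹(Ω)` while its restrictions to `∂Ω` converge to `t`
in `L²(∂Ω)`. -/
def IsTrace (Ω : Opens (Euc d)) (v : Euc d → ℂ) (G : Fin d → Euc d → ℂ) (t : Euc d → ℂ) : Prop :=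
  MemLp t 2 (surfaceMeasure Ω) ∧
  ∃ ψ : ℕ → 𝓓((⊤ : Opens (Euc d)), ℂ),
    Tendsto (fun n => eLpNorm (fun x => ψ n x - v x) 2 (volume.restrict (Ω : Set (Euc d))))
      atTop (𝓝 0) ∧
    (∀ j, Tendsto (fun n => eLpNorm (fun x => partialDeriv j (ψ n) x - G j x) 2
      (volume.restrict (Ω : Set (Euc d)))) atTop (𝓝 0)) ∧
    Tendsto (fun n => eLpNorm (fun x => ψ n x - t x) 2 (surfaceMeasure Ω)) atTop (𝓝 0)

/-- `u ∈ H¹(Ω)`, `Δ u ∈ L²(Ω)`, and the distributional outer normal derivative of `u` exists in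
`L²(∂Ω)` and equals `h`: for all `v ∈ H¹(Ω)`,
`∫_Ω ∇u · conj ∇v + Δu conj v dx = ∫_{∂Ω} h conj v dσ`. -/
def HasNormalDerivative (Ω : Opens (Euc d)) (u h : Euc d → ℂ) : Prop :=
  MemLp h 2 (surfaceMeasure Ω) ∧
  ∃ (G : Fin d → Euc d → ℂ) (w : Euc d → ℂ),
    IsH1With Ω u G ∧ MemLp w 2 (volume.restrict (Ω : Set (Euc d))) ∧ HasWeakLaplacian Ω u w ∧
    ∀ (v : Euc d → ℂ) (H : Fin d → Euc d → ℂ) (t : Euc d → ℂ),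
      IsH1With Ω v H → IsTrace Ω v H t →
      ∫ x in (Ω : Set (Euc d)), ((∑ j, G j x * star (H j x)) + w x * star (v x))
        = ∫ x, h x * star (t x) ∂(surfaceMeasure Ω)

/-- The domain `D(Δ^β)` of the Robin Laplacian on `C(Ω̄)`: all `u ∈ H¹(Ω) ∩ C(Ω̄)` whose
distributional Laplacian is in `L²(Ω) ∩ C(Ω̄)` and whose outer normal derivative exists in `L²(∂Ω)`
and equals `-β u`. For `β = 0` this is the domain of the Neumann Laplacian. -/
def robinDomain (Ω : Opens (Euc d)) (β : C(frontier (Ω : Set (Euc d)), ℂ)) :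
    Set C(closure (Ω : Set (Euc d)), ℂ) :=
  {u | (∃ G, IsH1With Ω (zeroExt u) G) ∧
    (∃ w : C(closure (Ω : Set (Euc d)), ℂ), HasWeakLaplacian Ω (zeroExt u) (zeroExt w)) ∧
    HasNormalDerivative Ω (zeroExt u) (fun x => -(zeroExt β x * zeroExt u x))}

end RobinIntertwining

end

open RobinIntertwining

namespace RobinIntertwining

open scoped ContDiff

variable {d : ℕ}

/-! A bounded disjointness preserving functional on `C(K)` is a multiple of a point evaluation.
Applied to `f ↦ U f y`, this gives `U f = H · (f ∘ T)` with `H = U 1`, and `T` is continuous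
wherever `H ≠ 0`, being recovered there from the quotients of `U` of the coordinate functions by `U
1`.

Call `y ∈ Ω₂` good if `H y ≠ 0` and `T y ∈ Ω₁`; by (c) the good set is dense. Near a good point,
cut-offs allow any smooth `f` in the intertwining relation. The harmonic choices `1` and `xᵢ` make
`H` and `H Tᵢ` weakly harmonic, hence smooth by Weyl's lemma. The choice `xᵢ xⱼ` then forces the
derivative of `T` to be orthogonal. Such a map has zero second derivative, and the relation for `xᵢ`
then reduces to `∇H = 0` (`rigid_of_intertwining`). So on each component `W` of the good set `H` is
a nonzero constant and `T` is a rigid motion `τ`.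

The crux is `τ(W) = Ω₁` (`image_component_eq`). If it fails, connectedness of `Ω₁` yields a point `y
∈ closure W` outside `W` with `τ y ∈ Ω₁`. If `y ∈ Ω₂`, then `y` is itself good and lies in `W`. If
`y ∈ ∂Ω₂`, local connectedness of a Lipschitz domain puts all of `Ω₂` near `y` into `W`, so every
smooth function would agree near `y` with an element of the Robin domain. Green's formula forbids
this (`not_forall_exists_mem_robinDomain`): the function `1` makes `β` vanish weakly near `y`, the
coordinates then give `∫_Ω ∂ₖv = 0` for all bumps `v` near `y`, and sliding a bump across the
boundary graph contradicts that.

Finally the components are disjoint, of equal positive volume, in a bounded set, so there are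
finitely many. Their closures cover the closure of `Ω₂`, where the continuous `H` takes finitely
many values and is therefore constant. -/

/-- The `j`-th standard basis vector. -/
noncomputable abbrev stdVec (j : Fin d) : Euc d := EuclideanSpace.single j 1

/-! ### The Laplacian in coordinates and integration by parts -/

theorem laplacian_eq_sum_fderiv {F : Type*} [NormedAddCommGroup F] [NormedSpace ℝ F]
    {f : Euc d → F} {x : Euc d} (hf : ContDiffAt ℝ 2 f x) :
    Laplacian.laplacian f x
      = ∑ i, fderiv ℝ (fun z => fderiv ℝ f z (stdVec i)) x (stdVec i) := by
  have h := congrFun (InnerProductSpace.laplacian_eq_iteratedFDeriv_orthonormalBasis f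
    (EuclideanSpace.basisFun (Fin d) ℝ)) x
  rw [h]
  refine Finset.sum_congr rfl fun i _ => ?_
  have hd : DifferentiableAt ℝ (fderiv ℝ f) x :=
    (hf.fderiv_right (m := 1) (by norm_num)).differentiableAt (by norm_num)
  rw [iteratedFDeriv_two_apply, fderiv_clm_apply hd (by fun_prop)]
  simp

theorem laplacian_mul {f g : Euc d → ℂ} {x : Euc d} (hf : ContDiffAt ℝ 2 f x)
    (hg : ContDiffAt ℝ 2 g x) :
    Laplacian.laplacian (fun z => f z * g z) x
      = f x * Laplacian.laplacian g x + g x * Laplacian.laplacian f x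
        + 2 * ∑ i, fderiv ℝ f x (stdVec i) * fderiv ℝ g x (stdVec i) := by
  rw [laplacian_eq_sum_fderiv hf, laplacian_eq_sum_fderiv hg,
    laplacian_eq_sum_fderiv (hf.mul hg), Finset.mul_sum, Finset.mul_sum, Finset.mul_sum,
    ← Finset.sum_add_distrib, ← Finset.sum_add_distrib]
  refine Finset.sum_congr rfl fun i _ => ?_
  have hdf : ∀ᶠ z in 𝓝 x, DifferentiableAt ℝ f z :=
    (hf.eventually (by simp)).mono fun z hz => hz.differentiableAt (by norm_num)
  have hdg : ∀ᶠ z in 𝓝 x, DifferentiableAt ℝ g z :=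
    (hg.eventually (by simp)).mono fun z hz => hz.differentiableAt (by norm_num)
  have hD : (fun z => fderiv ℝ (fun z => f z * g z) z (stdVec i)) =ᶠ[𝓝 x]
      fun z => f z * fderiv ℝ g z (stdVec i) + g z * fderiv ℝ f z (stdVec i) := by
    filter_upwards [hdf, hdg] with z h1 h2
    rw [fderiv_fun_mul h1 h2]
    simp
  have hf' : DifferentiableAt ℝ (fderiv ℝ f) x :=
    (hf.fderiv_right (m := 1) (by norm_num)).differentiableAt (by norm_num)
  have hg' : DifferentiableAt ℝ (fderiv ℝ g) x :=
    (hg.fderiv_right (m := 1) (by norm_num)).differentiableAt (by norm_num)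
  have hf1 := hdf.self_of_nhds
  have hg1 := hdg.self_of_nhds
  have hfi : DifferentiableAt ℝ (fun z => fderiv ℝ f z (stdVec i)) x :=
    hf'.clm_apply (by fun_prop)
  have hgi : DifferentiableAt ℝ (fun z => fderiv ℝ g z (stdVec i)) x :=
    hg'.clm_apply (by fun_prop)
  rw [hD.fderiv_eq, fderiv_fun_add (hf1.fun_mul hgi) (hg1.fun_mul hfi), fderiv_fun_mul hf1 hgi,
    fderiv_fun_mul hg1 hfi]
  simp only [_root_.add_apply, _root_.smul_apply, smul_eq_mul]
  ring

theorem contDiff_fderiv_apply {F : Type*} [NormedAddCommGroup F] [NormedSpace ℝ F]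
    {f : Euc d → F} (hf : ContDiff ℝ ∞ f) (e : Euc d) :
    ContDiff ℝ ∞ (fun z => fderiv ℝ f z e) :=
  (hf.fderiv_right (m := ∞) (by simp)).clm_apply contDiff_const

/-- Off the support of `ψ` the product is locally zero, so regularity of `u` on `V` alone suffices.
This lets later integrals run over the whole space although `u` is controlled only on `V`. -/
theorem continuous_mul_of_tsupport_subset {u ψ : Euc d → ℂ} {V : Set (Euc d)} (hV : IsOpen V)
    (hu : ContinuousOn u V) (hψ : Continuous ψ) (hs : tsupport ψ ⊆ V) :
    Continuous (fun x => u x * ψ x) := by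
  refine continuous_iff_continuousAt.2 fun x => ?_
  by_cases hx : x ∈ tsupport ψ
  · exact (hu.continuousAt (hV.mem_nhds (hs hx))).mul hψ.continuousAt
  · have : (fun x => u x * ψ x) =ᶠ[𝓝 x] fun _ => 0 := by
      filter_upwards [(isClosed_tsupport ψ).isOpen_compl.mem_nhds hx] with z hz
      rw [image_eq_zero_of_notMem_tsupport hz, mul_zero]
    exact this.continuousAt

theorem integrable_mul_of_tsupport_subset {u ψ : Euc d → ℂ} {V : Set (Euc d)} (hV : IsOpen V)
    (hu : ContinuousOn u V) (hψ : Continuous ψ) (hc : HasCompactSupport ψ) (hs : tsupport ψ ⊆ V) :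
    Integrable (fun x => u x * ψ x) :=
  (continuous_mul_of_tsupport_subset hV hu hψ hs).integrable_of_hasCompactSupport hc.mul_left

theorem integral_mul_fderiv_eq_neg {u ψ : Euc d → ℂ} {V : Set (Euc d)} (hV : IsOpen V)
    (hu : ContDiffOn ℝ 1 u V) (hψ : ContDiff ℝ 1 ψ) (hc : HasCompactSupport ψ)
    (hs : tsupport ψ ⊆ V) (e : Euc d) :
    ∫ x, u x * fderiv ℝ ψ x e = - ∫ x, fderiv ℝ u x e * ψ x := by
  have hu' : ContinuousOn (fun z => fderiv ℝ u z e) V :=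
    (hu.continuousOn_fderiv_of_isOpen hV (by norm_num)).clm_apply continuousOn_const
  refine integral_mul_fderiv_eq_neg_fderiv_mul_of_integrable
    (integrable_mul_of_tsupport_subset hV hu' hψ.continuous hc hs)
    (integrable_mul_of_tsupport_subset hV hu.continuousOn
      ((hψ.continuous_fderiv (by norm_num)).clm_apply continuous_const)
      (hc.fderiv_apply ℝ e) ((tsupport_fderiv_apply_subset ℝ e).trans hs))
    (integrable_mul_of_tsupport_subset hV hu.continuousOn hψ.continuous hc hs)
    (fun x hx => (hu.contDiffAt (hV.mem_nhds (hs hx))).differentiableAt (by norm_num))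
    (fun x _ => hψ.differentiable (by norm_num) x)

theorem integral_mul_laplacian_eq {u ψ : Euc d → ℂ} {V : Set (Euc d)} (hV : IsOpen V)
    (hu : ContDiffOn ℝ ∞ u V) (hψ : ContDiff ℝ ∞ ψ) (hc : HasCompactSupport ψ)
    (hs : tsupport ψ ⊆ V) :
    ∫ x, u x * Laplacian.laplacian ψ x = ∫ x, Laplacian.laplacian u x * ψ x := by
  have hdu : ∀ e, ContDiffOn ℝ ∞ (fun z => fderiv ℝ u z e) V := fun e =>
    (hu.fderiv_of_isOpen hV (m := ∞) (by simp)).clm_apply contDiffOn_const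
  have hddu : ∀ e, ContDiffOn ℝ ∞ (fun z => fderiv ℝ (fun z => fderiv ℝ u z e) z e) V := fun e =>
    ((hdu e).fderiv_of_isOpen hV (m := ∞) (by simp)).clm_apply contDiffOn_const
  have h1 : (fun x => u x * Laplacian.laplacian ψ x)
      = fun x => ∑ i, u x * fderiv ℝ (fun z => fderiv ℝ ψ z (stdVec i)) x (stdVec i) := by
    funext x
    rw [laplacian_eq_sum_fderiv (hψ.contDiffAt.of_le (by exact WithTop.coe_le_coe.2 le_top)),
      Finset.mul_sum]
  have h2 : (fun x => Laplacian.laplacian u x * ψ x)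
      = fun x => ∑ i, fderiv ℝ (fun z => fderiv ℝ u z (stdVec i)) x (stdVec i) * ψ x := by
    funext x
    by_cases hx : x ∈ tsupport ψ
    · rw [laplacian_eq_sum_fderiv ((hu.contDiffAt (hV.mem_nhds (hs hx))).of_le
        (by exact WithTop.coe_le_coe.2 le_top)), Finset.sum_mul]
    · simp [image_eq_zero_of_notMem_tsupport hx]
  rw [h1, h2, integral_finsetSum, integral_finsetSum]
  · refine Finset.sum_congr rfl fun i _ => ?_
    rw [integral_mul_fderiv_eq_neg hV (hu.of_le (by simp))
      ((contDiff_fderiv_apply hψ _).of_le (by simp)) (hc.fderiv_apply ℝ _)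
      ((tsupport_fderiv_apply_subset ℝ _).trans hs),
      integral_mul_fderiv_eq_neg hV ((hdu _).of_le (by simp)) (hψ.of_le (by simp)) hc hs, neg_neg]
  · intro i _
    exact integrable_mul_of_tsupport_subset hV (hddu _).continuousOn hψ.continuous hc hs
  · intro i _
    exact integrable_mul_of_tsupport_subset hV hu.continuousOn
      (contDiff_fderiv_apply (contDiff_fderiv_apply hψ _) _).continuous
      ((hc.fderiv_apply ℝ _).fderiv_apply ℝ _)
      (((tsupport_fderiv_apply_subset ℝ _).trans (tsupport_fderiv_apply_subset ℝ _)).trans hs)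

/-- The fundamental lemma of the calculus of variations for continuous functions. -/
theorem eqOn_zero_of_integral_mul_eq_zero {u : Euc d → ℂ} {V : Set (Euc d)} (hV : IsOpen V)
    (hu : ContinuousOn u V)
    (h : ∀ ψ : Euc d → ℂ, ContDiff ℝ ∞ ψ → HasCompactSupport ψ → tsupport ψ ⊆ V →
      ∫ x, u x * ψ x = 0) : EqOn u 0 V := by
  have hae : ∀ᵐ x ∂(volume : Measure (Euc d)), x ∈ V → u x = 0 := by
    refine hV.ae_eq_zero_of_integral_contDiff_smul_eq_zero
      (hu.locallyIntegrableOn hV.measurableSet) fun g hg hc hs => ?_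
    have hs' : tsupport (fun x => (g x : ℂ)) ⊆ tsupport g :=
      tsupport_comp_subset (g := ((↑) : ℝ → ℂ)) (by simp) g
    rw [← h (fun x => (g x : ℂ)) (Complex.ofRealCLM.contDiff.comp hg)
      (hc.comp_left (g := ((↑) : ℝ → ℂ)) (by simp)) (hs'.trans hs)]
    exact integral_congr_ae (ae_of_all _ fun x => by simp [mul_comm])
  have := (ae_restrict_iff' hV.measurableSet).2 hae
  exact Measure.eqOn_open_of_ae_eq this hV hu continuousOn_const

/-! ### Weyl's lemma by mollification -/

/-- The Laplacian of a radial function `q(|x|²)` is the divergence of `2 q'(|x|²) x`. -/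
theorem laplacian_radial {q : ℝ → ℝ} (hq : ContDiff ℝ ∞ q) (w : Euc d) :
    Laplacian.laplacian (fun x : Euc d => q (‖x‖ ^ 2)) w
      = d * (2 * deriv q (‖w‖ ^ 2))
        + fderiv ℝ (fun x : Euc d => 2 * deriv q (‖x‖ ^ 2)) w w := by
  have hn : ContDiff ℝ ∞ (fun x : Euc d => ‖x‖ ^ 2) := contDiff_norm_sq ℝ
  have hq' : ContDiff ℝ ∞ (deriv q) := by
    have := hq.iterate_deriv 1
    simpa using this
  have hρ : ContDiff ℝ ∞ (fun x : Euc d => 2 * deriv q (‖x‖ ^ 2)) :=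
    contDiff_const.mul (hq'.comp hn)
  have h1 : ∀ (i : Fin d) (z : Euc d), fderiv ℝ (fun x : Euc d => q (‖x‖ ^ 2)) z (stdVec i)
      = 2 * deriv q (‖z‖ ^ 2) * z i := by
    intro i z
    have hqd : HasDerivAt q (deriv q (‖z‖ ^ 2)) (‖z‖ ^ 2) :=
      (hq.differentiable (by simp) _).hasDerivAt
    have := hqd.comp_hasFDerivAt z (hasStrictFDerivAt_norm_sq z).hasFDerivAt
    rw [show (fun x : Euc d => q (‖x‖ ^ 2)) = q ∘ fun x : Euc d => ‖x‖ ^ 2 from rfl, this.fderiv]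
    simp [EuclideanSpace.inner_single_right]
    ring
  have hχ : ContDiff ℝ ∞ (fun x : Euc d => q (‖x‖ ^ 2)) := hq.comp hn
  rw [laplacian_eq_sum_fderiv (hχ.contDiffAt.of_le (by exact WithTop.coe_le_coe.2 le_top))]
  simp_rw [h1]
  have hρd := hρ.differentiable (by simp) w
  have h2 : ∀ i : Fin d, fderiv ℝ (fun z : Euc d => 2 * deriv q (‖z‖ ^ 2) * z i) w (stdVec i)
      = 2 * deriv q (‖w‖ ^ 2)
        + w i * fderiv ℝ (fun x : Euc d => 2 * deriv q (‖x‖ ^ 2)) w (stdVec i) := by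
    intro i
    have hp : HasFDerivAt (fun z : Euc d => z i) (EuclideanSpace.proj i : Euc d →L[ℝ] ℝ) w :=
      (EuclideanSpace.proj i : Euc d →L[ℝ] ℝ).hasFDerivAt
    rw [fderiv_fun_mul hρd hp.differentiableAt, hp.fderiv]
    simp
  simp_rw [h2, Finset.sum_add_distrib]
  congr 1
  · simp
  · generalize fderiv ℝ (fun x : Euc d => 2 * deriv q (‖x‖ ^ 2)) w = A
    conv_rhs => rw [← (EuclideanSpace.basisFun (Fin d) ℝ).sum_repr w, map_sum]
    simp

/-- A mollifier `ρ` for which the derivative in the scaling parameter is a Laplacian. -/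
theorem exists_radial_mollifier (hd : 1 ≤ d) :
    ∃ ρ χ : Euc d → ℝ, ContDiff ℝ ∞ ρ ∧ ContDiff ℝ ∞ χ ∧ (∀ x, 0 ≤ ρ x) ∧ ∫ x, ρ x = 1 ∧
      (∀ x, 1 < ‖x‖ → ρ x = 0) ∧ (∀ x, 1 < ‖x‖ → χ x = 0) ∧
      ∀ w, Laplacian.laplacian χ w = d * ρ w + fderiv ℝ ρ w w := by
  -- Increasing and zero for `s ≥ 1`: its derivative is then nonnegative and vanishes for `s > 1`,
  -- as a mollifier `2 q'(|x|²)` requires.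
  set q : ℝ → ℝ := fun s => - Real.smoothTransition (1 - s) with hqdef
  have hq : ContDiff ℝ ∞ q :=
    (Real.smoothTransition.contDiff.comp (contDiff_const.sub contDiff_id)).neg
  have hq' : ContDiff ℝ ∞ (deriv q) := by
    have := hq.iterate_deriv 1
    simpa using this
  have hmono : Monotone q := fun a b hab =>
    neg_le_neg (Real.smoothTransition.monotone (by linarith))
  have hq0 : ∀ s, 1 ≤ s → q s = 0 := fun s hs => by
    simp [hqdef, Real.smoothTransition.zero_of_nonpos (show 1 - s ≤ 0 by linarith)]
  have hdq0 : ∀ s, 1 < s → deriv q s = 0 := fun s hs => by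
    have : q =ᶠ[𝓝 s] fun _ => 0 := by
      filter_upwards [Ioi_mem_nhds hs] with t ht using hq0 t (le_of_lt ht)
    rw [this.deriv_eq]; simp
  have hsq : ∀ x : Euc d, 1 < ‖x‖ → 1 < ‖x‖ ^ 2 := fun x hx => by nlinarith
  have hn : ContDiff ℝ ∞ (fun x : Euc d => ‖x‖ ^ 2) := contDiff_norm_sq ℝ
  set r : Euc d → ℝ := fun x => 2 * deriv q (‖x‖ ^ 2) with hr
  have hrc : ContDiff ℝ ∞ r := contDiff_const.mul (hq'.comp hn)
  have hr0 : ∀ x, 0 ≤ r x := fun x => by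
    have := hmono.deriv_nonneg (x := ‖x‖ ^ 2)
    simp only [hr]; positivity
  have hrs : ∀ x, 1 < ‖x‖ → r x = 0 := fun x hx => by simp [hr, hdq0 _ (hsq x hx)]
  have hrcs : HasCompactSupport r := HasCompactSupport.intro (isCompact_closedBall 0 1)
    fun x hx => hrs x (by simpa using hx)
  -- As `q` rises from `-1` to `0`, some slope equals `1`; a point of squared norm `s` then
  -- witnesses that `r` is not identically zero.
  obtain ⟨s, hs, hs'⟩ : ∃ s ∈ Ioo (0 : ℝ) 1, deriv q s = (q 1 - q 0) / (1 - 0) :=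
    exists_deriv_eq_slope q zero_lt_one hq.continuous.continuousOn
      (hq.differentiable (by simp)).differentiableOn
  have hpos : 0 < ∫ x, r x := by
    refine hrc.continuous.integral_pos_of_hasCompactSupport_nonneg_nonzero hrcs hr0
      (x := EuclideanSpace.single (⟨0, hd⟩ : Fin d) (Real.sqrt s)) ?_
    have h0 : q 0 = -1 := by simp [hqdef]
    have h1 : q 1 = 0 := hq0 1 le_rfl
    simp [hr, Real.sq_sqrt hs.1.le, hs', h0, h1]
  set m := ∫ x, r x with hm
  refine ⟨fun x => m⁻¹ * r x, fun x => m⁻¹ * q (‖x‖ ^ 2), contDiff_const.mul hrc,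
    contDiff_const.mul (hq.comp hn), fun x => mul_nonneg (inv_nonneg.2 hpos.le) (hr0 x), ?_,
    fun x hx => by simp [hrs x hx], fun x hx => by simp [hq0 _ (hsq x hx).le], fun w => ?_⟩
  · rw [integral_const_mul, ← hm, inv_mul_cancel₀ hpos.ne']
  · have h1 : Laplacian.laplacian (m⁻¹ • fun x : Euc d => q (‖x‖ ^ 2)) w = _ :=
      InnerProductSpace.laplacian_smul m⁻¹ ((hq.comp hn).contDiffAt.of_le
        (by exact WithTop.coe_le_coe.2 le_top))
    have h2 : (fun x : Euc d => m⁻¹ * q (‖x‖ ^ 2)) = m⁻¹ • fun x : Euc d => q (‖x‖ ^ 2) := rfl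
    rw [h2, h1, laplacian_radial hq, fderiv_const_mul (hrc.differentiable (by simp) w)]
    simp only [_root_.smul_apply, smul_eq_mul, hr]
    ring

theorem fderiv_comp_smul_sub {F : Type*} [NormedAddCommGroup F] [NormedSpace ℝ F] {f : Euc d → F}
    (hf : Differentiable ℝ f) (c : ℝ) (y z e : Euc d) :
    fderiv ℝ (fun z => f (c • (y - z))) z e = -c • fderiv ℝ f (c • (y - z)) e := by
  have h1 : HasFDerivAt (fun z : Euc d => c • (y - z))
      (c • (-ContinuousLinearMap.id ℝ (Euc d))) z :=
    ((hasFDerivAt_id z).const_sub y).const_smul c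
  have h2 := (hf (c • (y - z))).hasFDerivAt.comp z h1
  rw [show (fun z => f (c • (y - z))) = f ∘ fun z => c • (y - z) from rfl, h2.fderiv]
  simp

theorem laplacian_comp_smul_sub {F : Type*} [NormedAddCommGroup F] [NormedSpace ℝ F]
    {f : Euc d → F} (hf : ContDiff ℝ ∞ f) (c : ℝ) (y z : Euc d) :
    Laplacian.laplacian (fun z => f (c • (y - z))) z
      = c ^ 2 • Laplacian.laplacian f (c • (y - z)) := by
  have h2 : (2 : ℕ∞ω) ≤ ∞ := by exact WithTop.coe_le_coe.2 le_top
  have hc : ContDiff ℝ ∞ (fun z => f (c • (y - z))) := hf.comp (by fun_prop)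
  rw [laplacian_eq_sum_fderiv (hc.contDiffAt.of_le h2),
    laplacian_eq_sum_fderiv (hf.contDiffAt.of_le h2), Finset.smul_sum]
  refine Finset.sum_congr rfl fun i _ => ?_
  simp_rw [fderiv_comp_smul_sub (hf.differentiable (by simp))]
  have hd := (contDiff_fderiv_apply hf (stdVec i)).differentiable (by simp)
  have hd' : DifferentiableAt ℝ (fun z => fderiv ℝ f (c • (y - z)) (stdVec i)) z :=
    DifferentiableAt.comp (g := fun z => fderiv ℝ f z (stdVec i)) z (hd _) (by fun_prop)
  rw [fderiv_fun_const_smul hd', _root_.smul_apply, fderiv_comp_smul_sub hd, smul_smul]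
  congr 1
  ring

theorem laplacian_ofReal {f : Euc d → ℝ} (hf : ContDiff ℝ ∞ f) (x : Euc d) :
    Laplacian.laplacian (fun z => (f z : ℂ)) x = (Laplacian.laplacian f x : ℂ) :=
  ContDiffAt.laplacian_CLM_comp_left (l := Complex.ofRealCLM)
    (hf.contDiffAt.of_le (by exact WithTop.coe_le_coe.2 le_top))

theorem contDiff_laplacian {F : Type*} [NormedAddCommGroup F] [NormedSpace ℝ F]
    {f : Euc d → F} (hf : ContDiff ℝ ∞ f) : ContDiff ℝ ∞ (Laplacian.laplacian f) := by
  have : Laplacian.laplacian f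
      = fun x => ∑ i, fderiv ℝ (fun z => fderiv ℝ f z (stdVec i)) x (stdVec i) :=
    funext fun x => laplacian_eq_sum_fderiv
      (hf.contDiffAt.of_le (by exact WithTop.coe_le_coe.2 le_top))
  rw [this]
  exact ContDiff.sum fun i _ => contDiff_fderiv_apply (contDiff_fderiv_apply hf _) _

theorem laplacian_eq_zero_of_forall_norm_gt {f : Euc d → ℝ} (h : ∀ x, 1 < ‖x‖ → f x = 0)
    {x : Euc d} (hx : 1 < ‖x‖) : Laplacian.laplacian f x = 0 := by
  have : f =ᶠ[𝓝 x] fun _ => 0 := by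
    filter_upwards [(isOpen_lt continuous_const continuous_norm).mem_nhds hx] with z hz using h z hz
  rw [InnerProductSpace.laplacian_congr_nhds this |>.self_of_nhds]
  simp

/-- **Weyl's lemma**: a continuous weakly harmonic function is smooth. -/
theorem contDiffOn_of_weakly_harmonic (hd : 1 ≤ d) {u : Euc d → ℂ} {V : Set (Euc d)}
    (hV : IsOpen V) (hu : ContinuousOn u V)
    (h : ∀ ψ : Euc d → ℂ, ContDiff ℝ ∞ ψ → HasCompactSupport ψ → tsupport ψ ⊆ V →
      ∫ x, u x * Laplacian.laplacian ψ x = 0) : ContDiffOn ℝ ∞ u V := by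
  intro y₀ hy₀
  obtain ⟨ρ, χ, hρ, hχ, hρ0, hρ1, hρs, hχs, hρχ⟩ := exists_radial_mollifier hd
  obtain ⟨r', hr', hball'⟩ := Metric.isOpen_iff.1 hV y₀ hy₀
  -- With this radius the closed ball of radius `2r` lies in `V` and contains every ball of radius
  -- `r` centred within distance `r` of `y₀`.
  set r := r' / 3 with hr
  have hr0 : 0 < r := by positivity
  have hball : Metric.closedBall y₀ (2 * r) ⊆ V :=
    (Metric.closedBall_subset_ball (by linarith)).trans hball'
  set B := Metric.closedBall y₀ (2 * r) with hB
  set g : Euc d → ℂ := B.indicator u with hg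
  have hgi : Integrable g := by
    rw [hg, integrable_indicator_iff measurableSet_closedBall]
    exact (hu.mono hball).integrableOn_compact (isCompact_closedBall _ _)
  have hρcs : HasCompactSupport ρ := HasCompactSupport.intro (isCompact_closedBall 0 1)
    fun x hx => hρs x (by simpa using hx)
  have hLc : Continuous (Laplacian.laplacian χ) := (contDiff_laplacian hχ).continuous
  have hLcs : HasCompactSupport (Laplacian.laplacian χ) :=
    HasCompactSupport.intro (isCompact_closedBall 0 1)
      fun x hx => laplacian_eq_zero_of_forall_norm_gt hχs (by simpa using hx)
  -- The mollification of `g` at scale `1/c`. By the relation between `ρ` and `χ`, the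
  -- `c`-derivative of `c ^ d * ρ (c • w)` is `c ^ (d - 1)` times the Laplacian of `χ` at `c • w`,
  -- so weak harmonicity makes `F y` independent of `c`.
  set F : Euc d → ℝ → ℂ := fun y c => ∫ z, (c ^ d * ρ (c • (y - z))) • g z with hF
  -- The condition `c > 1/r` confines the rescaled `χ` around `y` to `B`, where `g = u`, so it is an
  -- admissible test function.
  have hzero : ∀ y ∈ Metric.ball y₀ r, ∀ c : ℝ, r⁻¹ < c →
      ∫ z, Laplacian.laplacian χ (c • (y - z)) • g z = 0 := by
    intro y hy c hc
    have hc0 : 0 < c := (inv_pos.2 hr0).trans hc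
    have hcr : 1 < c * r := by
      have := (inv_lt_iff_one_lt_mul₀ hr0).1 hc
      linarith
    have hout : ∀ z, z ∉ B → 1 < ‖c • (y - z)‖ := fun z hz => by
      have hz' : 2 * r < dist z y₀ := by simpa [hB] using hz
      have hy' : dist y y₀ < r := hy
      have : r < dist y z := by
        have := dist_triangle z y y₀
        rw [dist_comm z y] at this
        linarith
      rw [norm_smul, Real.norm_of_nonneg hc0.le, ← dist_eq_norm]
      calc 1 < c * r := hcr
        _ ≤ c * dist y z := by gcongr
    set ψ : Euc d → ℂ := fun z => (χ (c • (y - z)) : ℂ) with hψ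
    have hψc : ContDiff ℝ ∞ ψ :=
      Complex.ofRealCLM.contDiff.comp (hχ.comp (by fun_prop : ContDiff ℝ ∞ fun z => c • (y - z)))
    have hψsub : Function.support ψ ⊆ B := fun z hz => by
      by_contra hzB
      exact hz (by simp [hψ, hχs _ (hout z hzB)])
    have hψts : tsupport ψ ⊆ B := closure_minimal hψsub Metric.isClosed_closedBall
    have hψcs : HasCompactSupport ψ :=
      (isCompact_closedBall y₀ (2 * r)).of_isClosed_subset (isClosed_tsupport _) hψts
    have := h ψ hψc hψcs (hψts.trans hball)
    have heq : ∀ z, u z * Laplacian.laplacian ψ z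
        = (c ^ 2 : ℝ) • (Laplacian.laplacian χ (c • (y - z)) • g z) := by
      intro z
      have h1 : Laplacian.laplacian ψ z
          = ((c ^ 2 * Laplacian.laplacian χ (c • (y - z)) : ℝ) : ℂ) := by
        rw [hψ, laplacian_ofReal (f := fun z => χ (c • (y - z))) (hχ.comp (by fun_prop)),
          laplacian_comp_smul_sub hχ, smul_eq_mul]
      rw [h1, smul_smul]
      by_cases hz : z ∈ B
      · rw [hg, indicator_of_mem hz, Complex.real_smul, mul_comm]
      · rw [laplacian_eq_zero_of_forall_norm_gt hχs (hout z hz)]; simp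
    simp_rw [heq] at this
    rw [integral_smul] at this
    exact (smul_eq_zero.1 this).resolve_left (by positivity)
  have hderiv : ∀ y ∈ Metric.ball y₀ r, ∀ c : ℝ, r⁻¹ < c → HasDerivAt (F y) 0 c := by
    intro y hy c hc
    have hc0 : 0 < c := (inv_pos.2 hr0).trans hc
    obtain ⟨M, hM⟩ := hLc.bounded_above_of_compact_support hLcs
    have hρint : ∀ x : ℝ, Integrable (fun z => (x ^ d * ρ (x • (y - z))) • g z) := by
      intro x
      obtain ⟨M', hM'⟩ := hρ.continuous.bounded_above_of_compact_support hρcs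
      have hcont : Continuous fun z => x ^ d * ρ (x • (y - z)) :=
        continuous_const.mul (hρ.continuous.comp (by fun_prop))
      refine hgi.bdd_smul (C := ‖x ^ d‖ * M') hcont.aestronglyMeasurable
        (ae_of_all _ fun z => ?_)
      rw [norm_mul]
      gcongr
      exact hM' _
    have hM0 : 0 ≤ M := (norm_nonneg _).trans (hM 0)
    have hmain := (hasDerivAt_integral_of_dominated_loc_of_deriv_le (μ := volume)
      (F := fun (x : ℝ) z => (x ^ d * ρ (x • (y - z))) • g z)
      (F' := fun (x : ℝ) z => (x ^ (d - 1) * Laplacian.laplacian χ (x • (y - z))) • g z)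
      (x₀ := c) (s := Ioo 0 (2 * c)) (bound := fun z => ((2 * c) ^ (d - 1) * M) * ‖g z‖)
      (Ioo_mem_nhds hc0 (by linarith))
      (Eventually.of_forall fun x => (hρint x).aestronglyMeasurable) (hρint c)
      (by
        have hcont : Continuous fun z => c ^ (d - 1) * Laplacian.laplacian χ (c • (y - z)) :=
          continuous_const.mul (hLc.comp (by fun_prop))
        exact hcont.aestronglyMeasurable.smul hgi.aestronglyMeasurable)
      (ae_of_all _ fun z x hx => by
        rw [norm_smul, norm_mul, norm_pow, Real.norm_of_nonneg hx.1.le]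
        gcongr
        · exact hx.1.le
        · exact hx.2.le
        · exact hM _)
      (hgi.norm.const_mul _)
      (ae_of_all _ fun z x hx => by
        have h1 : HasDerivAt (fun x : ℝ => x • (y - z)) (y - z) x := by
          simpa using (hasDerivAt_id x).smul_const (y - z)
        have h2 : HasDerivAt (fun x : ℝ => ρ (x • (y - z)))
            (fderiv ℝ ρ (x • (y - z)) (y - z)) x :=
          (hρ.differentiable (by simp) _).hasFDerivAt.comp_hasDerivAt x h1
        have h3 := ((hasDerivAt_pow d x).mul h2).smul_const (g z)
        refine h3.congr_deriv ?_
        congr 1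
        rw [hρχ, map_smul, smul_eq_mul]
        obtain ⟨k, rfl⟩ : ∃ k, d = k + 1 := ⟨d - 1, by omega⟩
        simp only [Nat.add_sub_cancel]
        ring)).2
    have h0 : ∫ z, (c ^ (d - 1) * Laplacian.laplacian χ (c • (y - z))) • g z = 0 := by
      simp_rw [mul_smul]
      rw [integral_smul, hzero y hy c hc, smul_zero]
    rw [h0] at hmain
    exact hmain
  set c₀ := r⁻¹ + 1 with hc₀
  have hval : ∀ y ∈ Metric.ball y₀ r, F y c₀ = u y := by
    intro y hy
    have hconst : ∀ c, r⁻¹ < c → F y c = F y c₀ := fun c hc =>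
      isOpen_Ioi.is_const_of_deriv_eq_zero (convex_Ioi r⁻¹).isPreconnected
        (fun c hc => (hderiv y hy c hc).differentiableAt.differentiableWithinAt)
        (fun c hc => (hderiv y hy c hc).deriv) hc (lt_add_one r⁻¹)
    have hyB : B ∈ 𝓝 y := by
      refine mem_of_superset (Metric.isOpen_ball.mem_nhds hy) ?_
      exact (Metric.ball_subset_ball (by linarith)).trans Metric.ball_subset_closedBall
    have hgu : g =ᶠ[𝓝 y] u := by
      filter_upwards [hyB] with z hz
      rw [hg, indicator_of_mem hz]
    have hgc : ContinuousAt g y :=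
      (hu.continuousAt (hV.mem_nhds (hball (mem_of_mem_nhds hyB)))).congr hgu.symm
    -- Approximate identity as `c → ∞`: the constant value of `F y` must be `u y`. Thus `u` equals
    -- near `y₀` a convolution with a smooth kernel at the fixed scale `c₀`.
    have hlim := tendsto_integral_comp_smul_smul_of_integrable' (μ := volume) hρ0 hρ1
      (by
        refine tendsto_const_nhds.congr' ?_
        have : ∀ᶠ x in Bornology.cobounded (Euc d), 1 < ‖x‖ :=
          tendsto_norm_cobounded_atTop.eventually_gt_atTop 1
        filter_upwards [this] with x hx
        rw [hρs x hx, mul_zero]) hgi hgc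
    rw [finrank_euclideanSpace_fin] at hlim
    have hlim' : Tendsto (F y) atTop (𝓝 (F y c₀)) := by
      refine tendsto_const_nhds.congr' ?_
      filter_upwards [eventually_gt_atTop r⁻¹] with c hc using (hconst c hc).symm
    rw [tendsto_nhds_unique hlim' hlim, hgu.self_of_nhds]
  have hsmooth : ContDiff ℝ ∞ (fun y => F y c₀) := by
    have hk : ContDiff ℝ ∞ (fun x : Euc d => c₀ ^ d * ρ (c₀ • x)) :=
      contDiff_const.mul (hρ.comp (by fun_prop))
    have hc0 : 0 < c₀ := by positivity
    have hkcs : HasCompactSupport (fun x : Euc d => c₀ ^ d * ρ (c₀ • x)) :=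
      (hρcs.comp_smul hc0.ne').mul_left
    exact hkcs.contDiff_convolution_right (n := ⊤) (ContinuousLinearMap.lsmul ℝ ℝ).flip
      hgi.locallyIntegrable hk
  refine (hsmooth.contDiffAt.congr_of_eventuallyEq ?_).contDiffWithinAt
  filter_upwards [Metric.ball_mem_nhds y₀ hr0] with y hy using (hval y hy).symm

/-! ### Disjointness preserving functionals -/

/-- A partition of unity splits any function into finitely many pieces, each killed by `L`. The
contrapositive produces a point in the support of a nonzero functional. -/
theorem apply_eq_zero_of_forall_local {K : Type*} [TopologicalSpace K] [CompactSpace K] [T2Space K]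
    (L : C(K, ℂ) →L[ℂ] ℂ)
    (h : ∀ x, ∃ V, IsOpen V ∧ x ∈ V ∧ ∀ g : C(K, ℂ), (∀ y ∉ V, g y = 0) → L g = 0) : L = 0 := by
  choose V hVo hxV hV using h
  obtain ⟨t, ht⟩ := isCompact_univ.elim_finite_subcover V hVo
    fun x _ => mem_iUnion.2 ⟨x, hxV x⟩
  obtain ⟨p, hp, hp1, -⟩ := exists_continuous_sum_one_of_isOpen_isCompact
    (s := fun i : Fin t.card => V (t.equivFin.symm i)) (fun i => hVo _) isCompact_univ
    (fun x hx => by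
      obtain ⟨i, hi, hxi⟩ := mem_iUnion₂.1 (ht hx)
      exact mem_iUnion.2 ⟨t.equivFin ⟨i, hi⟩, by simpa using hxi⟩)
  ext f
  let P : Fin t.card → C(K, ℂ) := fun i => ⟨fun x => (p i x : ℂ) * f x, by fun_prop⟩
  have hf : f = ∑ i, P i := by
    ext x
    have h1 := hp1 (mem_univ x)
    rw [ContinuousMap.sum_apply]
    change f x = ∑ i, (p i x : ℂ) * f x
    rw [← Finset.sum_mul, ← Complex.ofReal_sum, show ∑ i, p i x = 1 by simpa using h1]
    simp
  rw [hf, map_sum]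
  exact Finset.sum_eq_zero fun i _ => hV (t.equivFin.symm i) _ fun y hy => by
    have : y ∉ tsupport (p i) := fun hy' => hy (hp i hy')
    simp [P, image_eq_zero_of_notMem_tsupport this]

/-- A bounded disjointness preserving functional on `C(K)` is a multiple of a point evaluation. -/
theorem exists_eq_mul_apply_of_disjointness_preserving {K : Type*} [TopologicalSpace K]
    [CompactSpace K] [T2Space K] [Nonempty K] (L : C(K, ℂ) →L[ℂ] ℂ)
    (hL : ∀ f g : C(K, ℂ), f * g = 0 → L f * L g = 0) : ∃ x, ∀ f, L f = L 1 * f x := by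
  by_cases h0 : L = 0
  · exact ⟨Classical.arbitrary K, fun f => by simp [h0]⟩
  obtain ⟨x, hx⟩ : ∃ x, ∀ V, IsOpen V → x ∈ V →
      ∃ g : C(K, ℂ), (∀ y ∉ V, g y = 0) ∧ L g ≠ 0 := by
    by_contra! h
    exact h0 (apply_eq_zero_of_forall_local L fun x => by
      obtain ⟨V, h1, h2, h3⟩ := h x
      exact ⟨V, h1, h2, h3⟩)
  -- Some `g` supported in `V` has `L g ≠ 0`, while `f * g = 0`; disjointness preservation leaves
  -- only `L f = 0`.
  have hloc : ∀ (f : C(K, ℂ)) (V : Set K), IsOpen V → x ∈ V → (∀ y ∈ V, f y = 0) → L f = 0 := by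
    intro f V hV hxV hf
    obtain ⟨g, hg, hLg⟩ := hx V hV hxV
    have : f * g = 0 := by
      ext y
      by_cases hy : y ∈ V
      · simp [hf y hy]
      · simp [hg y hy]
    exact (mul_eq_zero.1 (hL f g this)).resolve_right hLg
  have hzero : ∀ f : C(K, ℂ), f x = 0 → L f = 0 := by
    intro f hf
    have hbound : ∀ ε > 0, ‖L f‖ ≤ ‖L‖ * ε := by
      intro ε hε
      -- Shrinks the modulus of `f` by `ε`, down to zero at most: the result vanishes on a
      -- neighbourhood of `x` and is uniformly within `ε` of `f`.
      let fε : C(K, ℂ) := ⟨fun y => ((max (‖f y‖ - ε) 0 / max ‖f y‖ ε : ℝ) : ℂ) * f y, by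
        have : ∀ y, max ‖f y‖ ε ≠ 0 := fun y => (lt_max_of_lt_right hε).ne'
        fun_prop (disch := assumption)⟩
      have h1 : L fε = 0 := hloc fε {y | ‖f y‖ < ε} (isOpen_lt (by fun_prop) continuous_const)
        (by simpa [hf] using hε) fun y hy => by
          have : max (‖f y‖ - ε) 0 = 0 := max_eq_right (by linarith [show ‖f y‖ < ε from hy])
          simp [fε, this]
      have h2 : ‖f - fε‖ ≤ ε := by
        refine (ContinuousMap.norm_le _ hε.le).2 fun y => ?_
        have : (f - fε) y = ((1 - max (‖f y‖ - ε) 0 / max ‖f y‖ ε : ℝ) : ℂ) * f y := by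
          simp [fε]; ring
        rw [this, norm_mul, Complex.norm_real]
        rcases le_total ‖f y‖ ε with hy | hy
        · rw [max_eq_right (by linarith : ‖f y‖ - ε ≤ 0)]
          simpa using hy
        · have hpos : 0 < ‖f y‖ := hε.trans_le hy
          rw [max_eq_left (by linarith : 0 ≤ ‖f y‖ - ε), max_eq_left hy]
          have : 1 - (‖f y‖ - ε) / ‖f y‖ = ε / ‖f y‖ := by field_simp; ring
          rw [this, Real.norm_of_nonneg (by positivity), div_mul_cancel₀ _ hpos.ne']
      calc ‖L f‖ = ‖L (f - fε)‖ := by rw [map_sub, h1, sub_zero]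
        _ ≤ ‖L‖ * ‖f - fε‖ := L.le_opNorm _
        _ ≤ ‖L‖ * ε := by gcongr
    have hlim : Tendsto (fun ε : ℝ => ‖L‖ * ε) (𝓝[>] 0) (𝓝 (‖L‖ * 0)) :=
      (tendsto_id.const_mul ‖L‖).mono_left nhdsWithin_le_nhds
    have := ge_of_tendsto hlim (eventually_mem_nhdsWithin.mono fun ε hε => hbound ε hε)
    simpa using this
  refine ⟨x, fun f => ?_⟩
  have := hzero (f - (f x) • (1 : C(K, ℂ))) (by simp)
  rw [map_sub, map_smul, sub_eq_zero] at this
  rw [this, smul_eq_mul, mul_comm]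

/-! ### Local rigidity of operators commuting with the Laplacian -/

theorem eqOn_laplacian_of_weak {u w : Euc d → ℂ} {V : Set (Euc d)} (hV : IsOpen V)
    (hu : ContDiffOn ℝ ∞ u V) (hw : ContinuousOn w V)
    (h : ∀ ψ : Euc d → ℂ, ContDiff ℝ ∞ ψ → HasCompactSupport ψ → tsupport ψ ⊆ V →
      ∫ x, u x * Laplacian.laplacian ψ x = ∫ x, w x * ψ x) :
    EqOn (Laplacian.laplacian u) w V := by
  have hΔ : ContinuousOn (Laplacian.laplacian u) V := by
    have hdu : ∀ e, ContDiffOn ℝ ∞ (fun z => fderiv ℝ u z e) V := fun e =>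
      (hu.fderiv_of_isOpen hV (m := ∞) (by simp)).clm_apply contDiffOn_const
    have hddu : ∀ e, ContinuousOn (fun z => fderiv ℝ (fun z => fderiv ℝ u z e) z e) V := fun e =>
      ((hdu e).continuousOn_fderiv_of_isOpen hV (by simp)).clm_apply continuousOn_const
    refine (continuousOn_finsetSum Finset.univ fun i _ => hddu (stdVec i)).congr fun x hx => ?_
    rw [laplacian_eq_sum_fderiv ((hu.contDiffAt (hV.mem_nhds hx)).of_le
      (by exact WithTop.coe_le_coe.2 le_top))]
  have h0 := eqOn_zero_of_integral_mul_eq_zero (u := fun x => Laplacian.laplacian u x - w x) hV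
    (hΔ.sub hw) fun ψ hψ hc hs => by
      simp_rw [sub_mul]
      rw [integral_sub (integrable_mul_of_tsupport_subset hV hΔ hψ.continuous hc hs)
        (integrable_mul_of_tsupport_subset hV hw hψ.continuous hc hs), ← h ψ hψ hc hs,
        integral_mul_laplacian_eq hV hu hψ hc hs, sub_self]
  exact fun x hx => sub_eq_zero.1 (h0 hx)

/-- A map whose derivative is everywhere a linear isometry has vanishing second derivative. -/
theorem fderiv_fderiv_eq_zero_of_isometric {T : Euc d → Euc d} {V : Set (Euc d)} (hV : IsOpen V)
    (hT : ContDiffOn ℝ ∞ T V)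
    (hi : ∀ x ∈ V, ∀ v w, inner ℝ (fderiv ℝ T x v) (fderiv ℝ T x w) = inner ℝ v w)
    {x : Euc d} (hx : x ∈ V) : fderiv ℝ (fderiv ℝ T) x = 0 := by
  have hTx : ContDiffAt ℝ ∞ T x := hT.contDiffAt (hV.mem_nhds hx)
  have hdT : DifferentiableAt ℝ (fderiv ℝ T) x :=
    (hTx.fderiv_right (m := 1) (by exact WithTop.coe_le_coe.2 le_top)).differentiableAt (by simp)
  set D := fderiv ℝ (fderiv ℝ T) x with hD
  have hsymm : ∀ u v, D u v = D v u := fun u v =>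
    (hTx.isSymmSndFDerivAt
      (by simpa using (by exact WithTop.coe_le_coe.2 le_top : (2 : ℕ∞ω) ≤ ∞))) u v
  have hanti : ∀ u v w, inner ℝ (D u v) (fderiv ℝ T x w) = - inner ℝ (D u w) (fderiv ℝ T x v) := by
    intro u v w
    have hv : HasFDerivAt (fun z => fderiv ℝ T z v) (D.flip v) x := by
      simpa using hdT.hasFDerivAt.clm_apply (hasFDerivAt_const v x)
    have hw : HasFDerivAt (fun z => fderiv ℝ T z w) (D.flip w) x := by
      simpa using hdT.hasFDerivAt.clm_apply (hasFDerivAt_const w x)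
    have h1 := hv.inner ℝ hw
    have h2 : (fun z => (inner ℝ (fderiv ℝ T z v) (fderiv ℝ T z w) : ℝ))
        =ᶠ[𝓝 x] fun _ => inner ℝ v w := by
      filter_upwards [hV.mem_nhds hx] with z hz using hi z hz v w
    have h3 := (h1.congr_of_eventuallyEq h2.symm).unique (hasFDerivAt_const (inner ℝ v w) x)
    have h4 := congrArg (fun A : Euc d →L[ℝ] ℝ => A u) h3
    simp only [ContinuousLinearMap.coe_comp, Function.comp_apply, ContinuousLinearMap.prod_apply,
      fderivInnerCLM_apply, ContinuousLinearMap.flip_apply, _root_.zero_apply] at h4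
    rw [← real_inner_comm (D u w)]
    linarith
  -- The trilinear form `⟨D u v, DT w⟩` is symmetric in `u, v` and antisymmetric in `v, w`;
  -- alternating the two rules around the three arguments forces it to vanish.
  have hzero : ∀ u v w, inner ℝ (D u v) (fderiv ℝ T x w) = 0 := by
    intro u v w
    have h1 := hanti u v w
    have h2 := hanti w u v
    have h3 := hanti v w u
    rw [hsymm w u] at h2
    rw [hsymm v w] at h3
    rw [hsymm v u] at h3
    linarith
  have hinj : Function.Injective (fderiv ℝ T x : Euc d →ₗ[ℝ] Euc d) := by
    refine (injective_iff_map_eq_zero _).2 fun v hv => ?_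
    have := hi x hx v v
    rw [show fderiv ℝ T x v = 0 from hv, inner_zero_left] at this
    exact inner_self_eq_zero.1 this.symm
  have hsurj := LinearMap.injective_iff_surjective.1 hinj
  ext1 u
  ext1 v
  obtain ⟨w, hw⟩ := hsurj (D u v)
  have := hzero u v w
  rw [show fderiv ℝ T x w = D u v from hw] at this
  simpa using inner_self_eq_zero.1 this

theorem contDiff_coord (i : Fin d) : ContDiff ℝ ∞ (fun x : Euc d => (x i : ℂ)) :=
  Complex.ofRealCLM.contDiff.comp (EuclideanSpace.proj i : Euc d →L[ℝ] ℝ).contDiff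

theorem fderiv_coord (i : Fin d) (x e : Euc d) :
    fderiv ℝ (fun x : Euc d => (x i : ℂ)) x e = (e i : ℂ) := by
  have : HasFDerivAt (fun x : Euc d => (x i : ℂ))
      (Complex.ofRealCLM.comp (EuclideanSpace.proj i : Euc d →L[ℝ] ℝ)) x :=
    (Complex.ofRealCLM.comp (EuclideanSpace.proj i : Euc d →L[ℝ] ℝ)).hasFDerivAt
  rw [this.fderiv]
  simp

theorem laplacian_coord (i : Fin d) (x : Euc d) :
    Laplacian.laplacian (fun x : Euc d => (x i : ℂ)) x = 0 := by
  rw [laplacian_eq_sum_fderiv ((contDiff_coord i).contDiffAt.of_le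
    (by exact WithTop.coe_le_coe.2 le_top))]
  simp_rw [fderiv_coord]
  simp

theorem laplacian_coord_mul_coord (i j : Fin d) (x : Euc d) :
    Laplacian.laplacian (fun x : Euc d => (x i : ℂ) * (x j : ℂ)) x
      = 2 * (if i = j then 1 else 0) := by
  have h2 : (2 : ℕ∞ω) ≤ ∞ := by exact WithTop.coe_le_coe.2 le_top
  rw [laplacian_mul ((contDiff_coord i).contDiffAt.of_le h2)
    ((contDiff_coord j).contDiffAt.of_le h2), laplacian_coord, laplacian_coord]
  simp_rw [fderiv_coord]
  have hi : ∀ x : Fin d, ((if i = x then (1 : ℝ) else 0 : ℝ) : ℂ) = if i = x then 1 else 0 :=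
    fun x => by split_ifs <;> simp
  simp [eq_comm, hi]

/-- A weighted composition operator that commutes with the Laplacian has locally constant weight
and composes with a local isometry. -/
theorem rigid_of_intertwining (hd : 1 ≤ d) {H : Euc d → ℂ} {T : Euc d → Euc d} {V : Set (Euc d)}
    (hV : IsOpen V) (hH : ContinuousOn H V) (hT : ContinuousOn T V) (hH0 : ∀ x ∈ V, H x ≠ 0)
    (h : ∀ f : Euc d → ℂ, ContDiff ℝ ∞ f → ∀ ψ : Euc d → ℂ, ContDiff ℝ ∞ ψ →
      HasCompactSupport ψ → tsupport ψ ⊆ V →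
      ∫ x, H x * f (T x) * Laplacian.laplacian ψ x
        = ∫ x, H x * Laplacian.laplacian f (T x) * ψ x) :
    ContDiffOn ℝ ∞ H V ∧ ContDiffOn ℝ ∞ T V ∧ ∀ x ∈ V, fderiv ℝ H x = 0 ∧
      fderiv ℝ (fderiv ℝ T) x = 0 ∧
      ∀ v w, inner ℝ (fderiv ℝ T x v) (fderiv ℝ T x w) = inner ℝ v w := by
  have h2 : (2 : ℕ∞ω) ≤ ∞ := by exact WithTop.coe_le_coe.2 le_top
  have hcont : ∀ f : Euc d → ℂ, Continuous f → ContinuousOn (fun x => H x * f (T x)) V :=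
    fun f hf => hH.mul (hf.comp_continuousOn hT)
  -- Used for `f = 1` and `f = xᵢ`: first `H`, then `H Tᵢ`, and after division by `H` the components
  -- of `T` are smooth.
  have hweyl : ∀ f : Euc d → ℂ, ContDiff ℝ ∞ f → (∀ x, Laplacian.laplacian f x = 0) →
      ContDiffOn ℝ ∞ (fun x => H x * f (T x)) V := by
    intro f hf hf0
    refine contDiffOn_of_weakly_harmonic hd hV (hcont f hf.continuous) fun ψ hψ hc hs => ?_
    rw [h f hf ψ hψ hc hs]
    simp [hf0]
  have hHs : ContDiffOn ℝ ∞ H V := by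
    simpa using hweyl (fun _ => 1) contDiff_const fun x => by simp
  have hts : ∀ i, ContDiffOn ℝ ∞ (fun x => (T x i : ℂ)) V := fun i =>
    ((hweyl _ (contDiff_coord i) (laplacian_coord i)).mul (hHs.inv hH0)).congr fun x hx => by
      simp [mul_comm (H x), mul_inv_cancel_right₀ (hH0 x hx)]
  have hTs : ContDiffOn ℝ ∞ T V := by
    refine contDiffOn_euclidean.2 fun i => ?_
    exact Complex.reCLM.contDiff.comp_contDiffOn (hts i)
  have hcl : ∀ f : Euc d → ℂ, ContDiff ℝ ∞ f →
      EqOn (Laplacian.laplacian fun x => H x * f (T x))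
        (fun x => H x * Laplacian.laplacian f (T x)) V := fun f hf =>
    eqOn_laplacian_of_weak hV (hHs.mul (hf.comp_contDiffOn hTs))
      (hcont _ (contDiff_laplacian hf).continuous) (h f hf)
  have hH2 : ∀ x ∈ V, ContDiffAt ℝ 2 H x := fun x hx =>
    (hHs.contDiffAt (hV.mem_nhds hx)).of_le h2
  have ht2 : ∀ i, ∀ x ∈ V, ContDiffAt ℝ 2 (fun x => (T x i : ℂ)) x := fun i x hx =>
    ((hts i).contDiffAt (hV.mem_nhds hx)).of_le h2
  have hTd : ∀ x ∈ V, DifferentiableAt ℝ T x := fun x hx =>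
    (hTs.contDiffAt (hV.mem_nhds hx)).differentiableAt (by simp)
  have hdt : ∀ i, ∀ x ∈ V, ∀ e, fderiv ℝ (fun x => (T x i : ℂ)) x e
      = ((fderiv ℝ T x e) i : ℂ) := by
    intro i x hx e
    have h1 : HasFDerivAt (fun x => (T x i : ℂ))
        ((Complex.ofRealCLM.comp (EuclideanSpace.proj i : Euc d →L[ℝ] ℝ)).comp (fderiv ℝ T x)) x :=
      (Complex.ofRealCLM.comp (EuclideanSpace.proj i : Euc d →L[ℝ] ℝ)).hasFDerivAt.comp x
        (hTd x hx).hasFDerivAt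
    rw [h1.fderiv]
    simp
  have hΔH : ∀ x ∈ V, Laplacian.laplacian H x = 0 := fun x hx => by
    simpa using hcl (fun _ => 1) contDiff_const hx
  have hΔ1 : ∀ i, ∀ x ∈ V, H x * Laplacian.laplacian (fun x => (T x i : ℂ)) x
      + 2 * ∑ k, fderiv ℝ H x (stdVec k) * fderiv ℝ (fun x => (T x i : ℂ)) x (stdVec k) = 0 := by
    intro i x hx
    have h1 := hcl _ (contDiff_coord i) hx
    simp only [laplacian_coord, mul_zero] at h1
    rw [laplacian_mul (hH2 x hx) (ht2 i x hx), hΔH x hx] at h1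
    simpa using h1
  -- Expand the Laplacian of `(H Tᵢ) · Tⱼ`. The factor `H Tᵢ` is harmonic and the terms of `hΔ1` for
  -- `j` cancel, leaving `2 H ∇Tᵢ · ∇Tⱼ`.
  have horth : ∀ x ∈ V, ∀ i j, ∑ k, (fderiv ℝ T x (stdVec k)) i * (fderiv ℝ T x (stdVec k)) j
      = if i = j then 1 else 0 := by
    intro x hx i j
    have h1 := hcl _ ((contDiff_coord i).mul (contDiff_coord j)) hx
    have h3 := hcl _ (contDiff_coord i) hx
    simp only [laplacian_coord, mul_zero] at h3
    rw [show (fun x => H x * ((T x i : ℂ) * (T x j : ℂ)))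
      = fun x => (fun x => H x * (T x i : ℂ)) x * (fun x => (T x j : ℂ)) x from
        funext fun x => (mul_assoc _ _ _).symm,
      laplacian_mul ((hH2 x hx).mul (ht2 i x hx)) (ht2 j x hx), h3] at h1
    have h4 : ∀ k, fderiv ℝ (fun x => H x * (T x i : ℂ)) x (stdVec k)
        = H x * fderiv ℝ (fun x => (T x i : ℂ)) x (stdVec k)
          + (T x i : ℂ) * fderiv ℝ H x (stdVec k) := fun k => by
      rw [fderiv_fun_mul ((hH2 x hx).differentiableAt (by simp))
        ((ht2 i x hx).differentiableAt (by simp))]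
      simp
    simp only [laplacian_coord_mul_coord, h4, add_mul, Finset.sum_add_distrib, mul_zero,
      add_zero] at h1
    have h5 := hΔ1 j x hx
    have h6 : H x * (2 * (∑ k, fderiv ℝ (fun x => (T x i : ℂ)) x (stdVec k)
        * fderiv ℝ (fun x => (T x j : ℂ)) x (stdVec k)))
        = H x * (2 * (if i = j then 1 else 0)) := by
      rw [← h1]
      simp_rw [mul_assoc, ← Finset.mul_sum]
      linear_combination (-(T x i : ℂ)) * h5
    have h7 := mul_left_cancel₀ two_ne_zero (mul_left_cancel₀ (hH0 x hx) h6)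
    simp_rw [hdt _ x hx] at h7
    refine Complex.ofReal_injective ?_
    split_ifs at h7 ⊢ <;> push_cast <;> exact h7
  -- Orthonormal rows of a square matrix give orthonormal columns.
  have horth' : ∀ x ∈ V, ∀ k l,
      ∑ i, (fderiv ℝ T x (stdVec k)) i * (fderiv ℝ T x (stdVec l)) i
        = if k = l then 1 else 0 := by
    intro x hx k l
    let M : Matrix (Fin d) (Fin d) ℝ := Matrix.of fun i k => (fderiv ℝ T x (stdVec k)) i
    have h1 : M * M.transpose = 1 := by
      ext i j
      simpa [M, Matrix.mul_apply, Matrix.one_apply] using horth x hx i j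
    have h3 : M.transpose * M = 1 := mul_eq_one_comm.1 h1
    have := congrFun (congrFun h3 k) l
    simpa [M, Matrix.mul_apply, Matrix.one_apply] using this
  have hiso : ∀ x ∈ V, ∀ v w, inner ℝ (fderiv ℝ T x v) (fderiv ℝ T x w) = inner ℝ v w := by
    intro x hx v w
    have hb : ∀ k l, inner ℝ (fderiv ℝ T x (stdVec k)) (fderiv ℝ T x (stdVec l))
        = if k = l then (1 : ℝ) else 0 := fun k l => by
      rw [← horth' x hx k l, PiLp.inner_apply]
      exact Finset.sum_congr rfl fun i _ => by simp [mul_comm]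
    generalize fderiv ℝ T x = A at hb
    have hexp : ∀ v : Euc d, A v = ∑ k, v k • A (stdVec k) := fun v => by
      conv_lhs => rw [← (EuclideanSpace.basisFun (Fin d) ℝ).sum_repr v, map_sum]
      simp
    rw [hexp v, hexp w, sum_inner]
    simp_rw [inner_sum, inner_smul_left, inner_smul_right, hb]
    rw [PiLp.inner_apply]
    simp [mul_comm]
  have hDD : ∀ x ∈ V, fderiv ℝ (fderiv ℝ T) x = 0 := fun x hx =>
    fderiv_fderiv_eq_zero_of_isometric hV hTs hiso hx
  refine ⟨hHs, hTs, fun x hx => ⟨?_, hDD x hx, hiso x hx⟩⟩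
  -- Since `D²T = 0`, the first term of `hΔ1` drops out; what remains says that `DT` annihilates
  -- `∇H`, and `DT` is invertible.
  have hΔt : ∀ i, Laplacian.laplacian (fun x => (T x i : ℂ)) x = 0 := by
    intro i
    rw [laplacian_eq_sum_fderiv (ht2 i x hx)]
    refine Finset.sum_eq_zero fun k _ => ?_
    have h1 : (fun z => fderiv ℝ (fun x => (T x i : ℂ)) z (stdVec k)) =ᶠ[𝓝 x]
        fun z => (Complex.ofRealCLM.comp (EuclideanSpace.proj i : Euc d →L[ℝ] ℝ))
          (fderiv ℝ T z (stdVec k)) := by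
      filter_upwards [hV.mem_nhds hx] with z hz
      rw [hdt i z hz]; simp
    have hdT : DifferentiableAt ℝ (fderiv ℝ T) x :=
      ((hTs.contDiffAt (hV.mem_nhds hx)).fderiv_right (m := 1)
        (by exact WithTop.coe_le_coe.2 le_top)).differentiableAt (by simp)
    have h3 : HasFDerivAt (fun z => fderiv ℝ T z (stdVec k)) (0 : Euc d →L[ℝ] Euc d) x := by
      have := hdT.hasFDerivAt.clm_apply (hasFDerivAt_const (stdVec k) x)
      rw [hDD x hx] at this
      simpa using this
    have h4 := (Complex.ofRealCLM.comp
      (EuclideanSpace.proj i : Euc d →L[ℝ] ℝ)).hasFDerivAt.comp x h3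
    rw [h1.fderiv_eq]
    rw [show (fun z => (Complex.ofRealCLM.comp (EuclideanSpace.proj i : Euc d →L[ℝ] ℝ))
          (fderiv ℝ T z (stdVec k))) = (Complex.ofRealCLM.comp
      (EuclideanSpace.proj i : Euc d →L[ℝ] ℝ)) ∘ fun z => fderiv ℝ T z (stdVec k) from rfl,
      h4.fderiv]
    simp
  have hgrad : ∀ i, ∑ k, fderiv ℝ H x (stdVec k) * ((fderiv ℝ T x (stdVec k)) i : ℂ) = 0 := by
    intro i
    have h1 := hΔ1 i x hx
    rw [hΔt i] at h1
    simpa [hdt i x hx] using h1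
  have hstd : ∀ l, fderiv ℝ H x (stdVec l) = 0 := by
    intro l
    have h1 : ∑ i, (∑ k, fderiv ℝ H x (stdVec k) * ((fderiv ℝ T x (stdVec k)) i : ℂ))
        * ((fderiv ℝ T x (stdVec l)) i : ℂ) = 0 := by simp [hgrad]
    simp_rw [Finset.sum_mul] at h1
    rw [Finset.sum_comm] at h1
    simp_rw [mul_assoc, ← Finset.mul_sum] at h1
    have h3 : ∀ k, (∑ i, ((fderiv ℝ T x (stdVec k)) i : ℂ) * ((fderiv ℝ T x (stdVec l)) i : ℂ))
        = if k = l then 1 else 0 := fun k => by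
      have := congrArg ((↑) : ℝ → ℂ) (horth' x hx k l)
      split_ifs at this ⊢ <;> push_cast at this <;> exact this
    simpa [h3] using h1
  generalize fderiv ℝ H x = A at hstd ⊢
  ext v
  rw [← (EuclideanSpace.basisFun (Fin d) ℝ).sum_repr v, map_sum]
  simp [hstd]

/-! ### Geometry and surface measure of Lipschitz boundaries -/

/-- The orthogonal projection onto the hyperplane `eᗮ`. -/
noncomputable abbrev hyperProj (e : Euc d) : Euc d →L[ℝ] (Submodule.span ℝ {e})ᗮ :=
  (Submodule.span ℝ {e})ᗮ.orthogonalProjectionOnto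

theorem hyperProj_add_inner_smul {e : Euc d} (he : ‖e‖ = 1) (x : Euc d) :
    (hyperProj e x : Euc d) + (inner ℝ e x : ℝ) • e = x := by
  have h := (Submodule.span ℝ {e}).starProjection_add_starProjection_orthogonal x
  rw [Submodule.starProjection_unit_singleton ℝ he] at h
  rw [add_comm]
  exact h

theorem inner_hyperplane {e : Euc d} (p : (Submodule.span ℝ {e})ᗮ) : inner ℝ e (p : Euc d) = 0 :=
  (Submodule.mem_orthogonal_singleton_iff_inner_right).1 p.2

theorem hyperProj_add_smul {e : Euc d} (p : (Submodule.span ℝ {e})ᗮ) (s : ℝ) :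
    hyperProj e (p + s • e) = p := by
  rw [map_add, map_smul, Submodule.orthogonalProjectionOnto_orthogonalComplement_singleton_eq_zero,
    smul_zero, add_zero, Submodule.orthogonalProjectionOnto_mem_subspace_eq_self]

theorem inner_add_smul {e : Euc d} (he : ‖e‖ = 1) (p : (Submodule.span ℝ {e})ᗮ) (s : ℝ) :
    inner ℝ e ((p : Euc d) + s • e) = s := by
  rw [inner_add_right, inner_hyperplane, inner_smul_right, real_inner_self_eq_norm_sq, he]
  simp

theorem hyperProj_add_smul_self {e : Euc d} (x : Euc d) (s : ℝ) :
    hyperProj e (x + s • e) = hyperProj e x := by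
  rw [map_add, map_smul, Submodule.orthogonalProjectionOnto_orthogonalComplement_singleton_eq_zero,
    smul_zero, add_zero]

/-- Frontier points of the region above a graph lie on the graph. -/
theorem eq_inner_of_mem_frontier {Ω : Set (Euc d)} {e : Euc d} {g : (Submodule.span ℝ {e})ᗮ → ℝ}
    (hg : Continuous g) {O : Set (Euc d)} (hO : IsOpen O)
    (h : ∀ x ∈ O, x ∈ Ω ↔ g (hyperProj e x) < inner ℝ e x) {x : Euc d} (hxO : x ∈ O)
    (hx : x ∈ frontier Ω) : g (hyperProj e x) = inner ℝ e x := by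
  have hgc : Continuous fun x => g (hyperProj e x) := hg.comp (hyperProj e).continuous
  have hic : Continuous fun x : Euc d => (inner ℝ e x : ℝ) := by fun_prop
  rcases lt_trichotomy (g (hyperProj e x)) (inner ℝ e x) with hlt | heq | hgt
  · refine absurd ?_ hx.2
    refine mem_interior_iff_mem_nhds.2 ?_
    filter_upwards [hO.mem_nhds hxO, (isOpen_lt hgc hic).mem_nhds hlt] with y hy hy'
    exact (h y hy).2 hy'
  · exact heq
  · have h1 := mem_closure_iff_nhds.1 hx.1 _
      (inter_mem (hO.mem_nhds hxO) ((isOpen_lt hic hgc).mem_nhds hgt))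
    obtain ⟨y, ⟨hyO, hy⟩, hyΩ⟩ := h1
    exact absurd ((h y hyO).1 hyΩ) (not_lt.2 (le_of_lt hy))

theorem HasLipschitzBoundary.exists_ball {Ω : Set (Euc d)} (hΩ : HasLipschitzBoundary Ω)
    {z : Euc d} (hz : z ∈ frontier Ω) : ∃ e : Euc d, ‖e‖ = 1 ∧
      ∃ (K : NNReal) (g : (Submodule.span ℝ {e})ᗮ → ℝ), LipschitzWith K g ∧
        ∃ δ > 0, ∀ x ∈ Metric.ball z δ, x ∈ Ω ↔ g (hyperProj e x) < inner ℝ e x := by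
  obtain ⟨e, he, K, g, hg, h⟩ := hΩ z hz
  obtain ⟨δ, hδ, h⟩ := Metric.eventually_nhds_iff_ball.1 h
  exact ⟨e, he, K, g, hg, δ, hδ, h⟩

/-- A Lipschitz domain is locally connected at its boundary points. -/
theorem HasLipschitzBoundary.exists_isPreconnected_inter {Ω : Set (Euc d)}
    (hΩ : HasLipschitzBoundary Ω) {z : Euc d} (hz : z ∈ frontier Ω) {O : Set (Euc d)}
    (hO : O ∈ 𝓝 z) : ∃ N, IsOpen N ∧ z ∈ N ∧ N ⊆ O ∧ IsPreconnected (N ∩ Ω) := by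
  obtain ⟨e, he, K, g, hg, δ, hδ, h⟩ := hΩ.exists_ball hz
  obtain ⟨δ', hδ', hO'⟩ := Metric.mem_nhds_iff.1 hO
  set R := min δ δ' / 2 with hR
  have hR0 : 0 < R := by positivity
  have hz0 := eq_inner_of_mem_frontier hg.continuous Metric.isOpen_ball h
    (Metric.mem_ball_self hδ) hz
  obtain ⟨r', hr', hgr⟩ := Metric.continuousAt_iff.1
    (hg.continuous.continuousAt (x := hyperProj e z)) R hR0
  set r := min r' R with hr
  have hr0 : 0 < r := lt_min hr' hR0
  -- A cylinder with axis `e`: its base radius `r` keeps `g` within `R` of the height of `z`, so the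
  -- graph leaves neither through the top nor the bottom, and `R` is half of `min δ δ'` so that the
  -- cylinder fits in the ball.
  set N : Set (Euc d) := {x | ‖hyperProj e x - hyperProj e z‖ < r ∧
    |(inner ℝ e x : ℝ) - inner ℝ e z| < R} with hN
  have hNball : N ⊆ Metric.ball z (min δ δ') := by
    intro x hx
    have hxz : x - z = (hyperProj e x - hyperProj e z : (Submodule.span ℝ {e})ᗮ)
        + ((inner ℝ e x : ℝ) - inner ℝ e z) • e := by
      conv_lhs => rw [← hyperProj_add_inner_smul he x, ← hyperProj_add_inner_smul he z]
      rw [Submodule.coe_sub, sub_smul]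
      abel
    rw [Metric.mem_ball, dist_eq_norm, hxz]
    refine (norm_add_le _ _).trans_lt ?_
    rw [← Submodule.coe_norm, norm_smul, he, mul_one, Real.norm_eq_abs]
    have h1 : ‖hyperProj e x - hyperProj e z‖ < R := hx.1.trans_le (min_le_right _ _)
    have h2 := hx.2
    linarith
  refine ⟨N, ?_, ⟨by simpa using hr0, by simpa using hR0⟩,
    hNball.trans ((Metric.ball_subset_ball (min_le_right _ _)).trans hO'), ?_⟩
  · have h1 : Continuous fun x => ‖hyperProj e x - hyperProj e z‖ := by fun_prop
    have h2 : Continuous fun x : Euc d => |(inner ℝ e x : ℝ) - inner ℝ e z| := by fun_prop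
    exact (isOpen_lt h1 continuous_const).inter (isOpen_lt h2 continuous_const)
  · set s₀ : ℝ := inner ℝ e z
    -- Interpolates along each vertical fibre between the graph (parameter `0`) and the top of the
    -- cylinder (parameter `1`), exhibiting `N ∩ Ω` as a continuous image of a connected product.
    let Φ : (Submodule.span ℝ {e})ᗮ × ℝ → Euc d := fun q =>
      (q.1 : Euc d) + (g q.1 + q.2 * (s₀ + R - g q.1)) • e
    have hΦ : Continuous Φ := by
      have := hg.continuous
      fun_prop
    have himg : N ∩ Ω = Φ '' (Metric.ball (hyperProj e z) r ×ˢ Ioo 0 1) := by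
      ext x
      constructor
      · rintro ⟨hxN, hxΩ⟩
        have hx := (h x (Metric.ball_subset_ball (min_le_left _ _) (hNball hxN))).1 hxΩ
        have hs : (inner ℝ e x : ℝ) < s₀ + R := by linarith [(abs_lt.1 hxN.2).2]
        have hpos : 0 < s₀ + R - g (hyperProj e x) := by linarith
        refine ⟨(hyperProj e x, (inner ℝ e x - g (hyperProj e x)) / (s₀ + R - g (hyperProj e x))),
          ⟨by simpa [dist_eq_norm] using hxN.1, div_pos (by linarith) hpos,
            (div_lt_one hpos).2 (by linarith)⟩, ?_⟩
        simp only [Φ]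
        rw [div_mul_cancel₀ _ hpos.ne', add_sub_cancel, hyperProj_add_inner_smul he]
      · rintro ⟨⟨p, t⟩, ⟨hp, ht0, ht1⟩, rfl⟩
        have hp' : ‖p - hyperProj e z‖ < r := by simpa [dist_eq_norm] using hp
        have hgp : |g p - s₀| < R := by
          have := hgr (x := p) (hp.trans_le (min_le_left _ _))
          rwa [hz0, Real.dist_eq] at this
        have ht0' : 0 < t := ht0
        have ht1' : t < 1 := ht1
        obtain ⟨h1, h2⟩ := abs_lt.1 hgp
        have hlow : 0 < t * (s₀ + R - g p) := mul_pos ht0' (by linarith)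
        have hup : t * (s₀ + R - g p) < s₀ + R - g p := by nlinarith
        have hmem : Φ (p, t) ∈ N := by
          refine ⟨?_, ?_⟩
          · simp only [Φ]
            rw [hyperProj_add_smul]; exact hp'
          · simp only [Φ]
            rw [inner_add_smul he, abs_lt]
            constructor <;> linarith
        refine ⟨hmem, ?_⟩
        rw [h _ (Metric.ball_subset_ball (min_le_left _ _) (hNball hmem))]
        simp only [Φ]
        rw [hyperProj_add_smul, inner_add_smul he]
        linarith
    rw [himg]
    exact ((((convex_ball _ _).isPreconnected).prod isPreconnected_Ioo).image _ hΦ.continuousOn)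

/-- The surface measure of a Lipschitz domain is locally finite. -/
theorem HasLipschitzBoundary.exists_surfaceMeasure_lt_top (hd : 1 ≤ d) {Ω : Opens (Euc d)}
    (hΩ : HasLipschitzBoundary (Ω : Set (Euc d))) {z : Euc d}
    (hz : z ∈ frontier (Ω : Set (Euc d))) :
    ∃ N, IsOpen N ∧ z ∈ N ∧ surfaceMeasure Ω N < ⊤ := by
  obtain ⟨e, he, K, g, hg, δ, hδ, h⟩ := hΩ.exists_ball hz
  refine ⟨Metric.ball z δ, Metric.isOpen_ball, Metric.mem_ball_self hδ, ?_⟩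
  rw [surfaceMeasure, Measure.restrict_apply Metric.isOpen_ball.measurableSet]
  let Φ : (Submodule.span ℝ {e})ᗮ → Euc d := fun p => (p : Euc d) + g p • e
  have hΦ : LipschitzWith (1 + K * 1) Φ := by
    refine LipschitzWith.add (LipschitzWith.subtype_val _) ?_
    have h1 : LipschitzWith 1 (fun s : ℝ => s • e) := LipschitzWith.of_dist_le_mul fun s t => by
      rw [dist_eq_norm, ← sub_smul, norm_smul, he, dist_eq_norm]; simp
    rw [mul_comm]
    exact h1.comp hg
  have hsub : Metric.ball z δ ∩ frontier (Ω : Set (Euc d))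
      ⊆ Φ '' Metric.ball (hyperProj e z) δ := by
    rintro x ⟨hx, hxf⟩
    refine ⟨hyperProj e x, ?_, ?_⟩
    · rw [Metric.mem_ball, dist_eq_norm, ← map_sub]
      exact (Submodule.norm_orthogonalProjectionOnto_apply_le _ _).trans_lt
        (by simpa [dist_eq_norm] using hx)
    · simp only [Φ]
      rw [eq_inner_of_mem_frontier hg.continuous Metric.isOpen_ball h hx hxf,
        hyperProj_add_inner_smul he]
  have hfin : Module.finrank ℝ (Submodule.span ℝ {e})ᗮ = d - 1 := by
    have : Fact (Module.finrank ℝ (Euc d) = (d - 1) + 1) :=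
      ⟨by rw [finrank_euclideanSpace_fin]; omega⟩
    exact Submodule.finrank_orthogonal_span_singleton (𝕜 := ℝ) (by
      rintro rfl; simp at he)
  have hball : (μHE[d - 1] : Measure (Submodule.span ℝ {e})ᗮ) (Metric.ball (hyperProj e z) δ)
      < ⊤ := by
    rw [← hfin]
    exact measure_ball_lt_top
  refine (measure_mono hsub).trans_lt ?_
  -- The normalising constant depends only on the dimension `d - 1`, so it is the same on the
  -- hyperplane and in the ambient space; the Lipschitz bound for the unnormalised Hausdorff measure
  -- then applies.
  rw [Measure.euclideanHausdorffMeasure_def, Measure.smul_apply] at hball ⊢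
  set c := Measure.addHaarScalarFactor (volume : Measure (EuclideanSpace ℝ (Fin (d - 1))))
    μH[((d - 1 : ℕ) : ℝ)] with hc
  have hle := hΦ.hausdorffMeasure_image_le (d := ((d - 1 : ℕ) : ℝ)) (by positivity)
    (Metric.ball (hyperProj e z) δ)
  rw [ENNReal.smul_def, smul_eq_mul] at hball ⊢
  calc _ ≤ (c : ENNReal) * (((1 + K * 1 : NNReal) : ENNReal) ^ ((d - 1 : ℕ) : ℝ)
        * μH[((d - 1 : ℕ) : ℝ)] (Metric.ball (hyperProj e z) δ)) := by gcongr
    _ = ((1 + K * 1 : NNReal) : ENNReal) ^ ((d - 1 : ℕ) : ℝ)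
        * (c * μH[((d - 1 : ℕ) : ℝ)] (Metric.ball (hyperProj e z) δ)) := by ring
    _ < ⊤ := ENNReal.mul_lt_top (ENNReal.rpow_lt_top_of_nonneg (by positivity)
        ENNReal.coe_ne_top) hball

/-- Derivatives of test functions near a boundary point of a Lipschitz domain cannot all have
vanishing integral over the domain. -/
theorem HasLipschitzBoundary.not_forall_integral_fderiv_eq_zero {Ω : Set (Euc d)}
    (hΩ : HasLipschitzBoundary Ω) (hΩo : IsOpen Ω) {z : Euc d} (hz : z ∈ frontier Ω)
    {N : Set (Euc d)} (hN : N ∈ 𝓝 z) :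
    ¬ ∀ v : Euc d → ℂ, ContDiff ℝ ∞ v → HasCompactSupport v → tsupport v ⊆ N →
      ∀ e, ∫ x in Ω, fderiv ℝ v x e = 0 := by
  intro h
  obtain ⟨e, he, K, g, hg, δ₀, hδ₀, hΩg⟩ := hΩ.exists_ball hz
  obtain ⟨δ₁, hδ₁, hN⟩ := Metric.mem_nhds_iff.1 hN
  set δ := min δ₀ δ₁ with hδ
  have hδ0 : 0 < δ := lt_min hδ₀ hδ₁
  replace hΩg : ∀ x ∈ Metric.ball z δ, x ∈ Ω ↔ g (hyperProj e x) < inner ℝ e x := fun x hx =>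
    hΩg x (Metric.ball_subset_ball (min_le_left _ _) hx)
  replace hN : Metric.ball z δ ⊆ N := (Metric.ball_subset_ball (min_le_right _ _)).trans hN
  have hz0 := eq_inner_of_mem_frontier hg.continuous Metric.isOpen_ball hΩg
    (Metric.mem_ball_self hδ0) hz
  have hreal : ∀ v : Euc d → ℝ, ContDiff ℝ ∞ v → HasCompactSupport v → tsupport v ⊆ N →
      ∫ x in Ω, fderiv ℝ v x e = 0 := by
    intro v hv hc hs
    have h1 := h (fun x => (v x : ℂ)) (Complex.ofRealCLM.contDiff.comp hv)
      (hc.comp_left (g := ((↑) : ℝ → ℂ)) (by simp))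
      ((tsupport_comp_subset (g := ((↑) : ℝ → ℂ)) (by simp) v).trans hs) e
    have h2 : ∀ x, fderiv ℝ (fun x => (v x : ℂ)) x e = (fderiv ℝ v x e : ℂ) := fun x => by
      have : HasFDerivAt (fun x => (v x : ℂ)) (Complex.ofRealCLM.comp (fderiv ℝ v x)) x :=
        Complex.ofRealCLM.hasFDerivAt.comp x (hv.differentiable (by simp) x).hasFDerivAt
      rw [this.fderiv]
      simp
    simp_rw [h2] at h1
    rw [integral_complex_ofReal] at h1
    exact_mod_cast h1
  let b : ContDiffBump z := ⟨δ / 4, δ / 2, by positivity, by linarith⟩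
  set v : Euc d → ℝ := ⇑b with hv
  have hvc : ContDiff ℝ ∞ v := b.contDiff
  have hvcs : HasCompactSupport v := b.hasCompactSupport
  have htr : ∀ t : ℝ, |t| < δ / 2 → tsupport (fun x => v (x + t • e)) ⊆ Metric.ball z δ := by
    intro t ht x hx
    have h1 : x + t • e ∈ tsupport v :=
      tsupport_comp_subset_preimage v (f := fun x => x + t • e) (by fun_prop) hx
    rw [hv, b.tsupport_eq] at h1
    have h2 : dist x (x + t • e) = |t| := by
      rw [dist_self_add_right, norm_smul, he, mul_one, Real.norm_eq_abs]
    have h3 : dist (x + t • e) z ≤ δ / 2 := h1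
    have := dist_triangle x (x + t • e) z
    rw [Metric.mem_ball]
    linarith
  have htrcs : ∀ t : ℝ, HasCompactSupport (fun x => v (x + t • e)) := fun t =>
    hvcs.comp_homeomorph (Homeomorph.addRight (t • e))
  -- Slide the bump in the direction `e`. The derivative of `F` is the integral over `Ω` of a
  -- derivative of a test function supported in `N`, so under `h` the function `F` is constant for
  -- small shifts.
  set F : ℝ → ℝ := fun t => ∫ x in Ω, v (x + t • e) with hF
  have hint : ∀ t : ℝ, Integrable (fun x => v (x + t • e)) := fun t =>
    (hvc.continuous.comp (by fun_prop)).integrable_of_hasCompactSupport (htrcs t)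
  have hderiv : ∀ t ∈ Ioo (-(δ / 2)) (δ / 2), HasDerivAt F 0 t := by
    intro t ht
    have htabs : |t| < δ / 2 := abs_lt.2 ht
    have hdv : Continuous fun x => fderiv ℝ v x e := (contDiff_fderiv_apply hvc e).continuous
    obtain ⟨M, hM⟩ := hdv.bounded_above_of_compact_support (hvcs.fderiv_apply ℝ e)
    have hmain := (hasDerivAt_integral_of_dominated_loc_of_deriv_le
      (μ := volume.restrict Ω) (F := fun t x => v (x + t • e))
      (F' := fun t x => fderiv ℝ v (x + t • e) e) (x₀ := t) (s := Ioo (-(δ / 2)) (δ / 2))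
      (bound := (Metric.ball z δ).indicator fun _ => M) (Ioo_mem_nhds ht.1 ht.2)
      (Eventually.of_forall fun t => (hint t).aestronglyMeasurable.restrict)
      (hint t).integrableOn
      (hdv.comp (by fun_prop : Continuous fun x => x + t • e)).aestronglyMeasurable
      (ae_of_all _ fun x s hs => by
        by_cases hx : x ∈ Metric.ball z δ
        · rw [indicator_of_mem hx]; exact hM _
        · rw [indicator_of_notMem hx]
          have h1 : x + s • e ∉ tsupport v := fun h1 => hx <| by
            rw [hv, b.tsupport_eq] at h1
            have h2 : dist x (x + s • e) = |s| := by
              rw [dist_self_add_right, norm_smul, he, mul_one, Real.norm_eq_abs]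
            have h3 : dist (x + s • e) z ≤ δ / 2 := h1
            have := dist_triangle x (x + s • e) z
            have := abs_lt.2 hs
            rw [Metric.mem_ball]
            linarith
          have h2 : fderiv ℝ v (x + s • e) = 0 :=
            image_eq_zero_of_notMem_tsupport fun h2 => h1 (tsupport_fderiv_subset ℝ h2)
          rw [h2]; simp)
      (((integrable_indicator_iff measurableSet_ball).2
        (integrableOn_const measure_ball_lt_top.ne)).integrableOn)
      (ae_of_all _ fun x s hs => by
        have h1 : HasDerivAt (fun s : ℝ => x + s • e) e s := by
          simpa using ((hasDerivAt_id s).smul_const e).const_add x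
        exact (hvc.differentiable (by simp) _).hasFDerivAt.comp_hasDerivAt s h1)).2
    have h0 := hreal (fun x => v (x + t • e)) (hvc.comp (by fun_prop)) (htrcs t)
      ((htr t htabs).trans hN)
    have h2 : ∀ x, fderiv ℝ (fun x => v (x + t • e)) x e = fderiv ℝ v (x + t • e) e := fun x => by
      rw [fderiv_comp_add_right]
    simp_rw [h2] at h0
    rw [h0] at hmain
    exact hmain
  set t := δ / 4 with ht
  have ht0 : 0 < t := by positivity
  have hconst : F t = F 0 :=
    isOpen_Ioo.is_const_of_deriv_eq_zero (convex_Ioo _ _).isPreconnected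
      (fun s hs => (hderiv s hs).differentiableAt.differentiableWithinAt)
      (fun s hs => (hderiv s hs).deriv) ⟨by linarith, by linarith⟩ ⟨by linarith, by linarith⟩
  set χ : Euc d → ℝ := Ω.indicator fun _ => 1 with hχ
  have hχF : ∀ s : ℝ, F s = ∫ x, χ (x - s • e) * v x := by
    intro s
    have h1 : F s = ∫ x, χ x * v (x + s • e) := by
      simp only [hF, hχ]
      rw [← integral_indicator hΩo.measurableSet]
      congr 1
      funext x
      by_cases hx : x ∈ Ω <;> simp [hx]
    rw [h1, ← integral_sub_right_eq_self _ (s • e)]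
    simp
  have hχm : ∀ s : ℝ, Integrable (fun x => χ (x - s • e) * v x) := by
    intro s
    have hv0 : Integrable v := hvc.continuous.integrable_of_hasCompactSupport hvcs
    have : StronglyMeasurable fun x => χ (x - s • e) :=
      ((stronglyMeasurable_const.indicator hΩo.measurableSet).comp_measurable
        (measurable_id.sub_const (s • e)))
    refine hv0.bdd_mul (c := 1) this.aestronglyMeasurable (ae_of_all _ fun x => ?_)
    by_cases hx : x - s • e ∈ Ω <;> simp [hχ, hx]
  have hsub : ∀ x ∈ Metric.ball z (δ / 2), x - t • e ∈ Metric.ball z δ := fun x hx => by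
    have h2 : dist (x - t • e) x = t := by
      rw [dist_self_sub_left, norm_smul, he, mul_one, Real.norm_of_nonneg ht0.le]
    have := dist_triangle (x - t • e) x z
    have : dist x z < δ / 2 := hx
    rw [Metric.mem_ball]
    linarith
  have hproj : ∀ x, hyperProj e (x - t • e) = hyperProj e x := fun x => by
    rw [sub_eq_add_neg, ← neg_smul, hyperProj_add_smul_self]
  have hinner : ∀ x : Euc d, (inner ℝ e (x - t • e) : ℝ) = inner ℝ e x - t := fun x => by
    rw [inner_sub_right, inner_smul_right, real_inner_self_eq_norm_sq, he]; simp
  have hball2 : Metric.ball z (δ / 2) ⊆ Metric.ball z δ := Metric.ball_subset_ball (by linarith)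
  have hvsupp : ∀ x ∉ Metric.ball z (δ / 2), v x = 0 := fun x hx =>
    b.zero_of_le_dist (not_lt.1 hx)
  -- Moving the domain instead of the bump: a point lying above the graph after being lowered by `t`
  -- was above it before, so the difference of the two integrands has a sign.
  have hnonneg : ∀ x, 0 ≤ χ x * v x - χ (x - t • e) * v x := by
    intro x
    by_cases hx : x ∈ Metric.ball z (δ / 2)
    · rw [← sub_mul]
      refine mul_nonneg ?_ b.nonneg
      by_cases hx' : x - t • e ∈ Ω
      · have h1 := (hΩg _ (hsub x hx)).1 hx'
        rw [hproj, hinner] at h1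
        have h2 : x ∈ Ω := (hΩg _ (hball2 hx)).2 (by linarith)
        simp [hχ, hx', h2]
      · by_cases h2 : x ∈ Ω <;> simp [hχ, hx', h2]
    · simp [hvsupp x hx]
  have hint0 : ∫ x, (χ x * v x - χ (x - t • e) * v x) = 0 := by
    have h0 := hχF 0
    have h00 := hχm 0
    simp only [zero_smul, sub_zero] at h0 h00
    rw [integral_sub h00 (hχm t), ← hχF, ← h0, hconst, sub_self]
  have hae := (integral_eq_zero_iff_of_nonneg hnonneg (by
    have h00 := hχm 0
    simp only [zero_smul, sub_zero] at h00
    exact h00.sub (hχm t))).1 hint0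
  -- The layer of thickness `t` above the graph, where the two indicators differ and the bump is
  -- positive. It is a nonempty open set, hence not null.
  set A : Set (Euc d) := {x | x ∈ Metric.ball z (δ / 2) ∧ g (hyperProj e x) < inner ℝ e x ∧
    (inner ℝ e x : ℝ) < g (hyperProj e x) + t} with hA
  have hgc : Continuous fun x => g (hyperProj e x) := hg.continuous.comp (hyperProj e).continuous
  have hic : Continuous fun x : Euc d => (inner ℝ e x : ℝ) := by fun_prop
  have hAo : IsOpen A := Metric.isOpen_ball.inter
    ((isOpen_lt hgc hic).inter (isOpen_lt hic (hgc.add continuous_const)))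
  have hAne : A.Nonempty := by
    refine ⟨z + (t / 2) • e, ?_, ?_, ?_⟩
    · rw [Metric.mem_ball, dist_self_add_left, norm_smul, he, mul_one,
        Real.norm_of_nonneg (by positivity)]
      linarith
    all_goals
      rw [hyperProj_add_smul_self, inner_add_right, inner_smul_right, real_inner_self_eq_norm_sq,
        he, hz0]
      linarith
  have hApos := hAo.measure_pos volume hAne
  refine hApos.ne' (measure_mono_null (fun x hx => ?_) (ae_iff.1 hae))
  have h1 : x ∈ Ω := (hΩg x (hball2 hx.1)).2 hx.2.1
  have h2 : x - t • e ∉ Ω := fun h2 => by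
    have := (hΩg _ (hsub x hx.1)).1 h2
    rw [hproj, hinner] at this
    linarith [hx.2.2]
  have h3 : 0 < v x := b.pos_of_mem_ball hx.1
  simpa [hχ, h1, h2] using h3.ne'

/-! ### Weak derivatives and Green's formula in the Robin domain -/

theorem zeroExt_apply {S : Set (Euc d)} (u : C(S, ℂ)) {x : Euc d} (hx : x ∈ S) :
    zeroExt u x = u ⟨x, hx⟩ :=
  Subtype.val_injective.extend_apply (⇑u) 0 ⟨x, hx⟩

theorem continuousOn_zeroExt {S : Set (Euc d)} (u : C(S, ℂ)) : ContinuousOn (zeroExt u) S := by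
  rw [continuousOn_iff_continuous_domRestrict]
  refine u.continuous.congr fun x => ?_
  exact (zeroExt_apply u x.2).symm

theorem setIntegral_mul_eq_integral {Ω : Opens (Euc d)} (u : Euc d → ℂ) {ψ : Euc d → ℂ}
    (hψ : tsupport ψ ⊆ Ω) :
    ∫ x in (Ω : Set (Euc d)), u x * ψ x = ∫ x, u x * ψ x :=
  setIntegral_eq_integral_of_forall_compl_eq_zero fun x hx => by
    rw [image_eq_zero_of_notMem_tsupport fun h => hx (hψ h), mul_zero]

theorem tsupport_laplacian_subset {ψ : Euc d → ℂ} :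
    tsupport (Laplacian.laplacian ψ) ⊆ tsupport ψ := by
  refine closure_minimal (fun x hx => ?_) (isClosed_tsupport ψ)
  by_contra hxs
  refine hx ?_
  have : ψ =ᶠ[𝓝 x] fun _ => 0 := by
    filter_upwards [(isClosed_tsupport ψ).isOpen_compl.mem_nhds hxs] with z hz
      using image_eq_zero_of_notMem_tsupport hz
  rw [InnerProductSpace.laplacian_congr_nhds this |>.self_of_nhds]
  simp

theorem locallyIntegrableOn_of_memLp {Ω : Opens (Euc d)} {u : Euc d → ℂ}
    (hu : MemLp u 2 (volume.restrict (Ω : Set (Euc d)))) :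
    LocallyIntegrableOn u (Ω : Set (Euc d)) :=
  locallyIntegrableOn_of_locallyIntegrable_restrict (hu.locallyIntegrable (by norm_num))

theorem integrable_smul_of_locallyIntegrableOn {u : Euc d → ℂ} {V : Set (Euc d)}
    (hu : LocallyIntegrableOn u V) {g : Euc d → ℝ} (hg : Continuous g) (hc : HasCompactSupport g)
    (hs : tsupport g ⊆ V) : Integrable fun x => g x • u x := by
  have h1 := ((integrable_indicator_iff (isClosed_tsupport g).measurableSet).2
    (hu.integrableOn_compact_subset hs hc)).locallyIntegrable
  refine (h1.integrable_smul_left_of_hasCompactSupport hg hc).congr (ae_of_all _ fun x => ?_)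
  by_cases hx : x ∈ tsupport g
  · simp only [indicator_of_mem hx]
  · simp [image_eq_zero_of_notMem_tsupport hx]

theorem ae_eq_of_forall_setIntegral_mul_eq {Ω : Opens (Euc d)} {u v : Euc d → ℂ} {V : Set (Euc d)}
    (hV : IsOpen V) (hVΩ : V ⊆ Ω) (hu : MemLp u 2 (volume.restrict (Ω : Set (Euc d))))
    (hv : Continuous v)
    (h : ∀ φ : 𝓓(Ω, ℂ), tsupport φ ⊆ V →
      ∫ x in (Ω : Set (Euc d)), u x * φ x = ∫ x, v x * φ x) :
    ∀ᵐ x ∂(volume : Measure (Euc d)), x ∈ V → u x = v x := by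
  have hloc : LocallyIntegrableOn u V := (locallyIntegrableOn_of_memLp hu).mono_set hVΩ
  have hlocv : LocallyIntegrableOn v V := hv.locallyIntegrable.locallyIntegrableOn V
  have key := hV.ae_eq_zero_of_integral_contDiff_smul_eq_zero (f := fun x => u x - v x)
    (μ := volume) (hloc.sub hlocv) fun g hg hc hs => by
      have hs' : tsupport (fun x => (g x : ℂ)) ⊆ V :=
        (tsupport_comp_subset (g := ((↑) : ℝ → ℂ)) (by simp) g).trans hs
      let φ : 𝓓(Ω, ℂ) := ⟨fun x => (g x : ℂ), Complex.ofRealCLM.contDiff.comp hg,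
        hc.comp_left (g := ((↑) : ℝ → ℂ)) (by simp), hs'.trans hVΩ⟩
      have h1 := h φ hs'
      rw [setIntegral_mul_eq_integral u φ.tsupport_subset] at h1
      have h2 : ∀ x, g x • (u x - v x) = g x • u x - g x • v x := fun x => smul_sub _ _ _
      simp_rw [h2]
      rw [integral_sub (integrable_smul_of_locallyIntegrableOn hloc hg.continuous hc hs)
        (integrable_smul_of_locallyIntegrableOn hlocv hg.continuous hc hs), sub_eq_zero]
      have h3 : ∀ w : Euc d → ℂ, ∀ x, g x • w x = w x * φ x := fun w x => by
        rw [Complex.real_smul, mul_comm]; rfl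
      simp_rw [h3]
      exact h1
  filter_upwards [key] with x hx hxV using sub_eq_zero.1 (hx hxV)

theorem setIntegral_mul_congr {Ω : Opens (Euc d)} {u f ψ : Euc d → ℂ} {V : Set (Euc d)}
    (hVΩ : V ⊆ Ω) (huf : EqOn u f V) (hψ : tsupport ψ ⊆ V) :
    ∫ x in (Ω : Set (Euc d)), u x * ψ x = ∫ x, f x * ψ x := by
  rw [setIntegral_mul_eq_integral u (hψ.trans hVΩ)]
  refine integral_congr_ae (ae_of_all _ fun x => ?_)
  by_cases hx : x ∈ tsupport ψ
  · simp only [huf (hψ hx)]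
  · simp [image_eq_zero_of_notMem_tsupport hx]

/-- The gradient in the Robin domain is only given existentially. Testing against functions
supported in `V` identifies it with the classical one wherever `u` is smooth. -/
theorem IsH1With.ae_eq_fderiv {Ω : Opens (Euc d)} {u f : Euc d → ℂ} {G : Fin d → Euc d → ℂ}
    (h : IsH1With Ω u G) {V : Set (Euc d)} (hV : IsOpen V) (hVΩ : V ⊆ Ω)
    (hf : ContDiff ℝ ∞ f) (huf : EqOn u f V) (j : Fin d) :
    ∀ᵐ x ∂(volume : Measure (Euc d)), x ∈ V → G j x = fderiv ℝ f x (stdVec j) := by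
  refine ae_eq_of_forall_setIntegral_mul_eq hV hVΩ (h.2 j).1
    (contDiff_fderiv_apply hf _).continuous fun φ hφ => ?_
  have h1 := (h.2 j).2 φ
  have h2 : ∫ x in (Ω : Set (Euc d)), u x * partialDeriv j φ x
      = ∫ x, f x * fderiv ℝ φ x (stdVec j) :=
    setIntegral_mul_congr hVΩ huf ((tsupport_fderiv_apply_subset ℝ _).trans hφ)
  rw [h2, integral_mul_fderiv_eq_neg isOpen_univ (hf.of_le (by simp)).contDiffOn
    (φ.contDiff.of_le (by simp)) φ.hasCompactSupport (subset_univ _)] at h1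
  exact (neg_injective h1).symm

theorem HasWeakLaplacian.ae_eq_laplacian {Ω : Opens (Euc d)} {u w f : Euc d → ℂ}
    (h : HasWeakLaplacian Ω u w) (hw : MemLp w 2 (volume.restrict (Ω : Set (Euc d))))
    {V : Set (Euc d)} (hV : IsOpen V) (hVΩ : V ⊆ Ω)
    (hf : ContDiff ℝ ∞ f) (huf : EqOn u f V) :
    ∀ᵐ x ∂(volume : Measure (Euc d)), x ∈ V → w x = Laplacian.laplacian f x := by
  refine ae_eq_of_forall_setIntegral_mul_eq hV hVΩ hw (contDiff_laplacian hf).continuous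
    fun φ hφ => ?_
  rw [← h φ, setIntegral_mul_congr hVΩ huf (tsupport_laplacian_subset.trans hφ),
    integral_mul_laplacian_eq isOpen_univ hf.contDiffOn φ.contDiff φ.hasCompactSupport
      (subset_univ _)]

theorem isH1With_partialDeriv (Ω : Opens (Euc d)) {v : Euc d → ℂ} (hv : ContDiff ℝ ∞ v)
    (hc : HasCompactSupport v) : IsH1With Ω v fun j => partialDeriv j v := by
  refine ⟨(hv.continuous.memLp_of_hasCompactSupport hc).restrict _, fun j =>
    ⟨((contDiff_fderiv_apply hv _).continuous.memLp_of_hasCompactSupport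
      (hc.fderiv_apply ℝ _)).restrict _, fun φ => ?_⟩⟩
  have h1 : tsupport (partialDeriv j φ) ⊆ Ω :=
    (tsupport_fderiv_apply_subset ℝ _).trans φ.tsupport_subset
  rw [setIntegral_mul_eq_integral v h1, setIntegral_mul_eq_integral _ φ.tsupport_subset]
  exact integral_mul_fderiv_eq_neg isOpen_univ (hv.of_le (by simp)).contDiffOn
    (φ.contDiff.of_le (by simp)) φ.hasCompactSupport (subset_univ _) _

/-- The constant approximating sequence works; finiteness of the surface measure near the support
serves only to put `v` in `L²` of the boundary. -/
theorem isTrace_self (Ω : Opens (Euc d)) {v : Euc d → ℂ} (hv : ContDiff ℝ ∞ v)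
    (hc : HasCompactSupport v) {N : Set (Euc d)} (hN : IsOpen N) (hvN : tsupport v ⊆ N)
    (hσ : surfaceMeasure Ω N < ⊤) : IsTrace Ω v (fun j => partialDeriv j v) v := by
  obtain ⟨φ, hφ⟩ : ∃ φ : 𝓓((⊤ : Opens (Euc d)), ℂ), (φ : Euc d → ℂ) = v :=
    ⟨⟨v, hv, hc, fun _ _ => trivial⟩, rfl⟩
  refine ⟨?_, fun _ => φ, ?_, fun j => ?_, ?_⟩
  · obtain ⟨M, hM⟩ := hv.continuous.bounded_above_of_compact_support hc
    have : IsFiniteMeasure ((surfaceMeasure Ω).restrict N) := ⟨by simpa using hσ⟩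
    have h1 : MemLp v 2 ((surfaceMeasure Ω).restrict N) :=
      MemLp.of_bound hv.continuous.aestronglyMeasurable M (ae_of_all _ hM)
    have h2 : N.indicator v = v := by
      rw [indicator_eq_self]
      exact (subset_tsupport v).trans hvN
    rw [← h2]
    exact (memLp_indicator_iff_restrict hN.measurableSet).2 h1
  all_goals
    refine tendsto_const_nhds.congr fun _ => ?_
    simp [hφ]

/-- Green's formula with Robin boundary values for an element of the Robin domain that is smooth
near the support of the test function. -/
theorem integral_eq_of_mem_robinDomain {Ω : Opens (Euc d)}
    {β : C(frontier (Ω : Set (Euc d)), ℂ)} {u : C(closure (Ω : Set (Euc d)), ℂ)}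
    (hu : u ∈ robinDomain Ω β) {N : Set (Euc d)} (hN : IsOpen N) (hσ : surfaceMeasure Ω N < ⊤)
    {f : Euc d → ℂ} (hf : ContDiff ℝ ∞ f)
    (huf : ∀ x ∈ N ∩ closure (Ω : Set (Euc d)), zeroExt u x = f x)
    {v : Euc d → ℂ} (hv : ContDiff ℝ ∞ v) (hc : HasCompactSupport v) (hvN : tsupport v ⊆ N) :
    ∫ x in (Ω : Set (Euc d)), ((∑ j, fderiv ℝ f x (stdVec j) * star (fderiv ℝ v x (stdVec j)))
        + Laplacian.laplacian f x * star (v x))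
      = ∫ x, -(zeroExt β x * f x) * star (v x) ∂(surfaceMeasure Ω) := by
  obtain ⟨-, -, -, G, w, hG, hw, hwl, hgreen⟩ := hu
  have h := hgreen v _ v (isH1With_partialDeriv Ω hv hc) (isTrace_self Ω hv hc hN hvN hσ)
  have hVo : IsOpen (N ∩ Ω) := hN.inter Ω.isOpen
  have hVΩ : N ∩ Ω ⊆ (Ω : Set (Euc d)) := inter_subset_right
  have huf' : EqOn (zeroExt u) f (N ∩ Ω) := fun x hx => huf x ⟨hx.1, subset_closure hx.2⟩
  have hv0 : ∀ x, x ∉ N → v x = 0 := fun x hx =>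
    image_eq_zero_of_notMem_tsupport fun h => hx (hvN h)
  have hdv0 : ∀ x, x ∉ N → ∀ e, fderiv ℝ v x e = 0 := fun x hx e => by
    rw [image_eq_zero_of_notMem_tsupport fun h => hx (hvN (tsupport_fderiv_subset ℝ h))]
    rfl
  have hl : ∫ x in (Ω : Set (Euc d)), ((∑ j, G j x * star (partialDeriv j v x))
        + w x * star (v x))
      = ∫ x in (Ω : Set (Euc d)),
        ((∑ j, fderiv ℝ f x (stdVec j) * star (fderiv ℝ v x (stdVec j)))
        + Laplacian.laplacian f x * star (v x)) := by
    refine setIntegral_congr_ae Ω.isOpen.measurableSet ?_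
    filter_upwards [ae_all_iff.2 fun j => hG.ae_eq_fderiv hVo hVΩ hf huf' j,
      hwl.ae_eq_laplacian hw hVo hVΩ hf huf'] with x hx1 hx2 hxΩ
    by_cases hxN : x ∈ N
    · simp only [hx1 _ ⟨hxN, hxΩ⟩, hx2 ⟨hxN, hxΩ⟩]
      rfl
    · simp [partialDeriv, hv0 x hxN, hdv0 x hxN]
  rw [← hl, h]
  refine setIntegral_congr_fun isClosed_frontier.measurableSet fun x hx => ?_
  by_cases hxN : x ∈ N
  · simp only [huf x ⟨hxN, frontier_subset_closure hx⟩]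
  · simp [hv0 x hxN]

/-- Near a boundary point, the Robin domain does not realise all smooth functions. -/
theorem not_forall_exists_mem_robinDomain (hd : 1 ≤ d) {Ω : Opens (Euc d)}
    (hΩ : HasLipschitzBoundary (Ω : Set (Euc d))) {β : C(frontier (Ω : Set (Euc d)), ℂ)}
    {z : Euc d} (hz : z ∈ frontier (Ω : Set (Euc d))) {O : Set (Euc d)} (hO : O ∈ 𝓝 z) :
    ¬ ∀ f : Euc d → ℂ, ContDiff ℝ ∞ f →
      ∃ u ∈ robinDomain Ω β, ∀ x ∈ O ∩ Ω, zeroExt u x = f x := by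
  intro h
  obtain ⟨N₁, hN₁, hzN₁, hσ₁⟩ := hΩ.exists_surfaceMeasure_lt_top hd hz
  set N := N₁ ∩ interior O with hN
  have hNo : IsOpen N := hN₁.inter isOpen_interior
  have hzN : z ∈ N := ⟨hzN₁, mem_interior_iff_mem_nhds.2 hO⟩
  have hσ : surfaceMeasure Ω N < ⊤ := (measure_mono inter_subset_left).trans_lt hσ₁
  -- The boundary term of Green's formula sees values on `∂Ω`, so the agreement on the open set must
  -- be carried to the closure by continuity.
  have h' : ∀ f : Euc d → ℂ, ContDiff ℝ ∞ f → ∃ u ∈ robinDomain Ω β,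
      ∀ x ∈ N ∩ closure (Ω : Set (Euc d)), zeroExt u x = f x := by
    intro f hf
    obtain ⟨u, hu, huf⟩ := h f hf
    refine ⟨u, hu, fun x hx => ?_⟩
    have hne : (𝓝[N ∩ Ω] x).NeBot := by
      refine mem_closure_iff_nhdsWithin_neBot.1 ?_
      exact hNo.inter_closure hx
    have h1 : Tendsto (zeroExt u) (𝓝[N ∩ Ω] x) (𝓝 (zeroExt u x)) :=
      ((continuousOn_zeroExt u) x hx.2).mono_left
        (nhdsWithin_mono x (inter_subset_right.trans subset_closure))
    have h2 : Tendsto f (𝓝[N ∩ Ω] x) (𝓝 (f x)) :=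
      hf.continuous.continuousAt.mono_left nhdsWithin_le_nhds
    refine tendsto_nhds_unique h1 (h2.congr' ?_)
    filter_upwards [self_mem_nhdsWithin] with y hy
    exact (huf y ⟨interior_subset hy.1.2, hy.2⟩).symm
  obtain ⟨u₁, hu₁, hu₁f⟩ := h' (fun _ => 1) contDiff_const
  -- For `f = 1` the gradient and the Laplacian vanish and only the boundary term is left.
  have hone : ∀ v : Euc d → ℂ, ContDiff ℝ ∞ v → HasCompactSupport v → tsupport v ⊆ N →
      ∫ x, zeroExt β x * star (v x) ∂(surfaceMeasure Ω) = 0 := by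
    intro v hv hc hs
    have h1 := integral_eq_of_mem_robinDomain hu₁ hNo hσ contDiff_const hu₁f hv hc hs
    simpa [integral_neg] using h1
  have hcoord : ∀ v : Euc d → ℂ, ContDiff ℝ ∞ v → HasCompactSupport v → tsupport v ⊆ N →
      ∀ k, ∫ x in (Ω : Set (Euc d)), fderiv ℝ v x (stdVec k) = 0 := by
    intro v hv hc hs k
    obtain ⟨u, hu, huf⟩ := h' _ (contDiff_coord k)
    have h1 := integral_eq_of_mem_robinDomain hu hNo hσ (contDiff_coord k) huf hv hc hs
    -- For `f = xₖ` the boundary integrand is `β xₖ` times the conjugate of `v`; as `xₖ` is real it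
    -- can be absorbed into the test function, and the case `f = 1` removes it.
    have h2 := hone (fun x => (x k : ℂ) * v x) ((contDiff_coord k).mul hv) hc.mul_left
      ((tsupport_mul_subset_right).trans hs)
    have h3 : ∫ x, -(zeroExt β x * (x k : ℂ)) * star (v x) ∂(surfaceMeasure Ω) = 0 := by
      rw [← neg_eq_zero, ← integral_neg, ← h2]
      refine integral_congr_ae (ae_of_all _ fun x => ?_)
      simp only [star_mul', RCLike.star_def, Complex.conj_ofReal]
      ring
    rw [h3] at h1
    simp_rw [fderiv_coord, laplacian_coord] at h1
    have h4 : ∀ x, (∑ j, ((stdVec j : Euc d) k : ℂ) * star (fderiv ℝ v x (stdVec j)))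
        + 0 * star (v x) = (starRingEnd ℂ) (fderiv ℝ v x (stdVec k)) := fun x => by
      rw [Finset.sum_eq_single k]
      · simp
      · intro j _ hj
        simp [hj.symm]
      · simp
    simp_rw [h4] at h1
    rw [integral_conj] at h1
    simpa using h1
  refine hΩ.not_forall_integral_fderiv_eq_zero Ω.isOpen hz (hNo.mem_nhds hzN)
    fun v hv hc hs e => ?_
  have h1 : ∀ x, fderiv ℝ v x e = ∑ k, (e k : ℂ) * fderiv ℝ v x (stdVec k) := fun x => by
    generalize fderiv ℝ v x = A
    conv_lhs => rw [← (EuclideanSpace.basisFun (Fin d) ℝ).sum_repr e, map_sum]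
    simp
  simp_rw [h1]
  rw [integral_finsetSum]
  · refine Finset.sum_eq_zero fun k _ => ?_
    rw [integral_const_mul, hcoord v hv hc hs k, mul_zero]
  · intro k _
    exact (((contDiff_fderiv_apply hv _).continuous.integrable_of_hasCompactSupport
      (hc.fderiv_apply ℝ _)).const_mul _).integrableOn

/-! ### The weighted composition operator and its good set -/

/-- One fixed cut-off serves all `f`, so the radius can be chosen before `f`. This is what allows
arbitrary smooth functions in hypotheses about test functions. -/
theorem exists_testFunction_eqOn {Ω : Opens (Euc d)} {x : Euc d} (hx : x ∈ Ω) :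
    ∃ r > 0, ∀ f : Euc d → ℂ, ContDiff ℝ ∞ f →
      ∃ φ : 𝓓(Ω, ℂ), EqOn φ f (Metric.ball x r) := by
  obtain ⟨R, hR, hball⟩ := Metric.isOpen_iff.1 Ω.isOpen x hx
  let b : ContDiffBump x := ⟨R / 4, R / 2, by positivity, by linarith⟩
  refine ⟨R / 4, by positivity, fun f hf => ?_⟩
  have hts : tsupport (fun y => (b y : ℂ)) ⊆ Ω :=
    (tsupport_comp_subset (g := ((↑) : ℝ → ℂ)) (by simp) b).trans
      (b.tsupport_eq.le.trans ((Metric.closedBall_subset_ball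
        (show R / 2 < R by linarith)).trans hball))
  have hc : HasCompactSupport (fun y => (b y : ℂ)) :=
    b.hasCompactSupport.comp_left (g := ((↑) : ℝ → ℂ)) (by simp)
  refine ⟨⟨fun y => (b y : ℂ) * f y, (Complex.ofRealCLM.contDiff.comp b.contDiff).mul hf,
    hc.mul_right, (tsupport_mul_subset_left).trans hts⟩, fun y hy => ?_⟩
  have h1 : b y = 1 := b.one_of_mem_closedBall (Metric.ball_subset_closedBall hy)
  change (b y : ℂ) * f y = f y
  rw [h1, Complex.ofReal_one, one_mul]

/-- `U` is the weighted composition operator with weight `H` and symbol `T`. -/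
structure IsWeightedComposition (Ω₁ Ω₂ : Opens (Euc d))
    (U : C(closure (Ω₁ : Set (Euc d)), ℂ) →L[ℂ] C(closure (Ω₂ : Set (Euc d)), ℂ))
    (H : Euc d → ℂ) (T : Euc d → Euc d) : Prop where
  mapsTo : MapsTo T (closure (Ω₂ : Set (Euc d))) (closure (Ω₁ : Set (Euc d)))
  continuousOn : ContinuousOn H (closure (Ω₂ : Set (Euc d)))
  apply_eq : ∀ f, ∀ y ∈ closure (Ω₂ : Set (Euc d)), zeroExt (U f) y = H y * zeroExt f (T y)

theorem exists_isWeightedComposition {Ω₁ Ω₂ : Opens (Euc d)} (hΩ₁ : IsLipschitzDomain Ω₁)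
    (U : C(closure (Ω₁ : Set (Euc d)), ℂ) →L[ℂ] C(closure (Ω₂ : Set (Euc d)), ℂ))
    (ha : ∀ f g : C(closure (Ω₁ : Set (Euc d)), ℂ), f * g = 0 → U f * U g = 0) :
    ∃ H T, IsWeightedComposition Ω₁ Ω₂ U H T := by
  have : CompactSpace (closure (Ω₁ : Set (Euc d))) :=
    isCompact_iff_compactSpace.1 hΩ₁.isBounded.isCompact_closure
  have : Nonempty (closure (Ω₁ : Set (Euc d))) := hΩ₁.isConnected.nonempty.closure.to_subtype
  have key : ∀ y : closure (Ω₂ : Set (Euc d)), ∃ x, ∀ f, U f y = U 1 y * f x := fun y =>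
    exists_eq_mul_apply_of_disjointness_preserving
      ((ContinuousMap.evalCLM ℂ y).comp U) fun f g hfg => by
        have := congrArg (fun k : C(closure (Ω₂ : Set (Euc d)), ℂ) => k y) (ha f g hfg)
        simpa using this
  choose τ hτ using key
  refine ⟨zeroExt (U 1), Function.extend Subtype.val (fun y => (τ y : Euc d)) 0, ?_,
    continuousOn_zeroExt _, ?_⟩
  · intro y hy
    have := Subtype.val_injective.extend_apply (fun y => (τ y : Euc d)) 0 ⟨y, hy⟩
    simp only at this
    rw [this]
    exact (τ _).2
  · intro f y hy
    have := Subtype.val_injective.extend_apply (fun y => (τ y : Euc d)) 0 ⟨y, hy⟩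
    simp only at this
    rw [this, zeroExt_apply _ hy, zeroExt_apply _ hy, zeroExt_apply _ (τ _).2, hτ]

namespace IsWeightedComposition

variable {Ω₁ Ω₂ : Opens (Euc d)}
  {U : C(closure (Ω₁ : Set (Euc d)), ℂ) →L[ℂ] C(closure (Ω₂ : Set (Euc d)), ℂ)}
  {H : Euc d → ℂ} {T : Euc d → Euc d}

theorem zeroExt_restrictClosure {Ω : Opens (Euc d)} {f : Euc d → ℂ} (hf : Continuous f)
    {x : Euc d} (hx : x ∈ closure (Ω : Set (Euc d))) :
    zeroExt (restrictClosure Ω f hf) x = f x := by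
  rw [zeroExt_apply _ hx]; rfl

theorem apply_testFun (h : IsWeightedComposition Ω₁ Ω₂ U H T) (φ : 𝓓(Ω₁, ℂ)) {y : Euc d}
    (hy : y ∈ closure (Ω₂ : Set (Euc d))) : zeroExt (U (testFun φ)) y = H y * φ (T y) := by
  rw [h.apply_eq _ y hy]
  congr 1
  exact zeroExt_restrictClosure φ.continuous (h.mapsTo hy)

theorem apply_testLaplacian (h : IsWeightedComposition Ω₁ Ω₂ U H T) (φ : 𝓓(Ω₁, ℂ)) {y : Euc d}
    (hy : y ∈ closure (Ω₂ : Set (Euc d))) :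
    zeroExt (U (testLaplacian φ)) y = H y * Laplacian.laplacian (φ : Euc d → ℂ) (T y) := by
  rw [h.apply_eq _ y hy]
  congr 1
  exact zeroExt_restrictClosure (continuous_laplacian φ) (h.mapsTo hy)

/-- Where `H ≠ 0`, the coordinates of `T` are quotients of continuous functions, namely `U xᵢ`
divided by `H`. Where `H = 0` the value of `T` is arbitrary. -/
theorem continuousWithinAt (h : IsWeightedComposition Ω₁ Ω₂ U H T) {y : Euc d}
    (hy : y ∈ closure (Ω₂ : Set (Euc d))) (hH : H y ≠ 0) :
    ContinuousWithinAt T (closure (Ω₂ : Set (Euc d))) y := by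
  have hcoord : ∀ i, ContinuousWithinAt (fun z => (T z i : ℂ)) (closure (Ω₂ : Set (Euc d))) y := by
    intro i
    set k := restrictClosure Ω₁ (fun x : Euc d => (x i : ℂ)) (contDiff_coord i).continuous
    have h1 : ContinuousWithinAt (fun z => zeroExt (U k) z / H z)
        (closure (Ω₂ : Set (Euc d))) y :=
      (continuousOn_zeroExt (U k) y hy).div (h.continuousOn y hy) hH
    have h2 : ∀ z ∈ closure (Ω₂ : Set (Euc d)), H z ≠ 0 → (T z i : ℂ) = zeroExt (U k) z / H z := by
      intro z hz hHz
      rw [h.apply_eq _ z hz, zeroExt_restrictClosure _ (h.mapsTo hz), mul_div_cancel_left₀ _ hHz]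
    refine h1.congr_of_eventuallyEq ?_ (h2 y hy hH)
    filter_upwards [self_mem_nhdsWithin, (h.continuousOn y hy).eventually_ne hH] with z hz hHz
      using h2 z hz hHz
  have h3 : ContinuousWithinAt (fun z => (T z).ofLp) (closure (Ω₂ : Set (Euc d))) y :=
    continuousWithinAt_pi.2 fun i => Complex.continuous_re.continuousAt.comp_continuousWithinAt
      (hcoord i)
  exact (PiLp.continuous_toLp 2 _).continuousAt.comp_continuousWithinAt h3

/-- The points of `Ω₂` that the operator links to points of `Ω₁`. -/
def goodSet (Ω₁ Ω₂ : Opens (Euc d)) (H : Euc d → ℂ) (T : Euc d → Euc d) : Set (Euc d) :=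
  {y | y ∈ Ω₂ ∧ H y ≠ 0 ∧ T y ∈ Ω₁}

/-- The point `y` may lie on `∂Ω₂`; that case is what makes the boundary argument possible. -/
theorem eventually_mem (h : IsWeightedComposition Ω₁ Ω₂ U H T) {y : Euc d}
    (hy : y ∈ closure (Ω₂ : Set (Euc d))) (hH : H y ≠ 0) (hT : T y ∈ Ω₁) :
    ∀ᶠ z in 𝓝 y, z ∈ Ω₂ → z ∈ goodSet Ω₁ Ω₂ H T := by
  have h1 := (h.continuousOn y hy).eventually_ne hH
  have h2 := (h.continuousWithinAt hy hH).eventually_mem (Ω₁.isOpen.mem_nhds hT)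
  have h3 := eventually_nhdsWithin_iff.1 (h1.and h2)
  filter_upwards [h3] with z hz hzΩ
  exact ⟨hzΩ, hz (subset_closure hzΩ)⟩

theorem isOpen_goodSet (h : IsWeightedComposition Ω₁ Ω₂ U H T) : IsOpen (goodSet Ω₁ Ω₂ H T) := by
  refine isOpen_iff_mem_nhds.2 fun y hy => ?_
  filter_upwards [h.eventually_mem (subset_closure hy.1) hy.2.1 hy.2.2,
    Ω₂.isOpen.mem_nhds hy.1] with z hz hzΩ using hz hzΩ

/-- At a point of `Ω₂` that is not good, either the weight vanishes or `T y` misses the support of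
every test function, so every `U φ` vanishes there. -/
theorem subset_closure_goodSet (h : IsWeightedComposition Ω₁ Ω₂ U H T)
    (hc : ∀ W : Set (Euc d), IsOpen W → W ⊆ Ω₂ →
      (∀ φ : 𝓓(Ω₁, ℂ), ∀ y : closure (Ω₂ : Set (Euc d)), (y : Euc d) ∈ W → U (testFun φ) y = 0) →
      W = ∅) : (Ω₂ : Set (Euc d)) ⊆ closure (goodSet Ω₁ Ω₂ H T) := by
  have h1 := hc ((Ω₂ : Set (Euc d)) ∩ (closure (goodSet Ω₁ Ω₂ H T))ᶜ)
    (Ω₂.isOpen.inter isClosed_closure.isOpen_compl) inter_subset_left ?_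
  · intro y hy
    by_contra hy'
    exact (h1 ▸ (⟨hy, hy'⟩ : y ∈ (Ω₂ : Set (Euc d)) ∩ (closure (goodSet Ω₁ Ω₂ H T))ᶜ) :
      y ∈ (∅ : Set (Euc d)))
  · intro φ y hy
    have h2 := h.apply_testFun φ y.2
    rw [zeroExt_apply _ y.2] at h2
    by_contra hne
    have h3 : H y * φ (T y) ≠ 0 := h2 ▸ hne
    refine hy.2 (subset_closure ⟨hy.1, left_ne_zero_of_mul h3, ?_⟩)
    exact φ.tsupport_subset (subset_tsupport _ (right_ne_zero_of_mul h3))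

/-- Local rigidity of the weight and the symbol. -/
theorem rigid (hd : 1 ≤ d) (h : IsWeightedComposition Ω₁ Ω₂ U H T)
    (hb : ∀ φ : 𝓓(Ω₁, ℂ),
      HasWeakLaplacian Ω₂ (zeroExt (U (testFun φ))) (zeroExt (U (testLaplacian φ))))
    {y : Euc d} (hy : y ∈ goodSet Ω₁ Ω₂ H T) :
    ContDiffAt ℝ ∞ H y ∧ ContDiffAt ℝ ∞ T y ∧ fderiv ℝ H y = 0 ∧
      fderiv ℝ (fderiv ℝ T) y = 0 ∧
      ∀ v w, inner ℝ (fderiv ℝ T y v) (fderiv ℝ T y w) = inner ℝ v w := by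
  obtain ⟨r, hr, hcut⟩ := exists_testFunction_eqOn hy.2.2
  have hTc : ContinuousOn T (goodSet Ω₁ Ω₂ H T) := fun z hz =>
    (h.continuousWithinAt (subset_closure hz.1) hz.2.1).mono fun x hx => subset_closure hx.1
  have hHc : ContinuousOn H (goodSet Ω₁ Ω₂ H T) :=
    h.continuousOn.mono fun x hx => subset_closure hx.1
  -- On `V` the map `T` stays in the ball where the cut-off is `1`, so an arbitrary smooth `f` can
  -- stand for a test function.
  set V := goodSet Ω₁ Ω₂ H T ∩ T ⁻¹' Metric.ball (T y) r with hV
  have hVo : IsOpen V := hTc.isOpen_inter_preimage h.isOpen_goodSet Metric.isOpen_ball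
  have hyV : y ∈ V := mem_inter hy (mem_preimage.2 (Metric.mem_ball_self hr))
  have hVT : ∀ x ∈ V, T x ∈ Metric.ball (T y) r := fun x hx =>
    mem_preimage.1 (mem_of_mem_inter_right hx)
  have hVg : V ⊆ goodSet Ω₁ Ω₂ H T := inter_subset_left
  have hVΩ : V ⊆ Ω₂ := fun x hx => (hVg hx).1
  clear_value V
  have hweak : ∀ f : Euc d → ℂ, ContDiff ℝ ∞ f → ∀ ψ : Euc d → ℂ, ContDiff ℝ ∞ ψ →
      HasCompactSupport ψ → tsupport ψ ⊆ V →
      ∫ x, H x * f (T x) * Laplacian.laplacian ψ x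
        = ∫ x, H x * Laplacian.laplacian f (T x) * ψ x := by
    intro f hf ψ hψ hψc hψs
    obtain ⟨φ, hφ⟩ := hcut f hf
    obtain ⟨Ψ, hΨ⟩ : ∃ Ψ : 𝓓(Ω₂, ℂ), (Ψ : Euc d → ℂ) = ψ :=
      ⟨⟨ψ, hψ, hψc, hψs.trans hVΩ⟩, rfl⟩
    have h4 := hb φ Ψ
    rw [hΨ] at h4
    have h5 : EqOn (zeroExt (U (testFun φ))) (fun x => H x * f (T x)) V := fun x hx => by
      rw [h.apply_testFun φ (subset_closure (hVΩ hx)), hφ (hVT x hx)]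
    have h6 : EqOn (zeroExt (U (testLaplacian φ)))
        (fun x => H x * Laplacian.laplacian f (T x)) V := fun x hx => by
      have h7 : (φ : Euc d → ℂ) =ᶠ[𝓝 (T x)] f := by
        filter_upwards [Metric.isOpen_ball.mem_nhds (hVT x hx)] with z hz using hφ hz
      rw [h.apply_testLaplacian φ (subset_closure (hVΩ hx)),
        (InnerProductSpace.laplacian_congr_nhds h7).self_of_nhds]
    rw [setIntegral_mul_congr hVΩ h5 (tsupport_laplacian_subset.trans hψs),
      setIntegral_mul_congr hVΩ h6 hψs] at h4
    exact h4
  obtain ⟨h1, h2, h3⟩ := rigid_of_intertwining hd hVo (hHc.mono hVg)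
    (hTc.mono hVg) (fun x hx => (hVg hx).2.1) hweak
  exact ⟨h1.contDiffAt (hVo.mem_nhds hyV), h2.contDiffAt (hVo.mem_nhds hyV), h3 y hyV⟩

/-- On connected sets of linked points the weight is constant and the symbol is a rigid motion. -/
theorem exists_isometry (hd : 1 ≤ d) (h : IsWeightedComposition Ω₁ Ω₂ U H T)
    (hb : ∀ φ : 𝓓(Ω₁, ℂ),
      HasWeakLaplacian Ω₂ (zeroExt (U (testFun φ))) (zeroExt (U (testLaplacian φ))))
    {W : Set (Euc d)} (hW : IsOpen W) (hWc : IsConnected W) (hWs : W ⊆ goodSet Ω₁ Ω₂ H T) :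
    ∃ (c : ℂ) (τ : Euc d ≃ᵢ Euc d), c ≠ 0 ∧ ContDiff ℝ ∞ τ.symm ∧
      (∀ y ∈ W, H y = c ∧ T y = τ y) := by
  have hrig := fun y (hy : y ∈ W) => h.rigid hd hb (hWs hy)
  obtain ⟨y₀, hy₀⟩ := hWc.nonempty
  have hTd : ∀ y ∈ W, DifferentiableAt ℝ T y := fun y hy =>
    (hrig y hy).2.1.differentiableAt (by simp)
  obtain ⟨c, hcH⟩ := hW.exists_is_const_of_fderiv_eq_zero (𝕜 := ℝ) hWc.isPreconnected (f := H)
    (fun y hy => ((hrig y hy).1.differentiableAt (by simp)).differentiableWithinAt)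
    (fun y hy => (hrig y hy).2.2.1)
  obtain ⟨A, hA⟩ := hW.exists_is_const_of_fderiv_eq_zero (𝕜 := ℝ) hWc.isPreconnected
    (f := fderiv ℝ T)
    (fun y hy => (((hrig y hy).2.1.fderiv_right (m := 1)
      (by exact WithTop.coe_le_coe.2 le_top)).differentiableAt (by simp)).differentiableWithinAt)
    (fun y hy => (hrig y hy).2.2.2.1)
  have hAi : ∀ v w, inner ℝ (A v) (A w) = inner ℝ v w := by
    rw [← hA y₀ hy₀]; exact (hrig y₀ hy₀).2.2.2.2
  obtain ⟨b, hb'⟩ := hW.exists_is_const_of_fderiv_eq_zero (𝕜 := ℝ) hWc.isPreconnected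
    (f := fun y => T y - A y)
    (fun y hy => ((hTd y hy).sub A.differentiableAt).differentiableWithinAt)
    (fun y hy => by
      rw [fderiv_fun_sub (hTd y hy) A.differentiableAt, hA y hy, A.fderiv, sub_self]; rfl)
  -- Preservation of inner products makes `A` injective, hence bijective by equality of dimensions.
  let L : Euc d ≃ₗᵢ[ℝ] Euc d :=
    ((A : Euc d →ₗ[ℝ] Euc d).isometryOfInner hAi).toLinearIsometryEquiv rfl
  have hL : ∀ y, L y = A y := fun y => rfl
  refine ⟨c, L.toIsometryEquiv.trans (IsometryEquiv.addRight b), ?_, ?_, fun y hy =>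
    ⟨hcH y hy, ?_⟩⟩
  · rw [← hcH y₀ hy₀]; exact (hWs hy₀).2.1
  · exact L.symm.contDiff.comp (contDiff_id.sub contDiff_const)
  · have := hb' y hy
    simp only [IsometryEquiv.trans_apply, LinearIsometryEquiv.coe_toIsometryEquiv,
      IsometryEquiv.addRight_apply, hL]
    rw [← this]; abel

end IsWeightedComposition

/-! ### Each component is mapped onto the whole of `Ω₁` -/

namespace IsWeightedComposition

variable {Ω₁ Ω₂ : Opens (Euc d)}
  {U : C(closure (Ω₁ : Set (Euc d)), ℂ) →L[ℂ] C(closure (Ω₂ : Set (Euc d)), ℂ)}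
  {H : Euc d → ℂ} {T : Euc d → Euc d}

theorem eq_on_closure (h : IsWeightedComposition Ω₁ Ω₂ U H T) {W : Set (Euc d)} {c : ℂ}
    {τ : Euc d → Euc d} (hτ : Continuous τ) (hc : c ≠ 0) (hWs : W ⊆ Ω₂)
    (hW : ∀ y ∈ W, H y = c ∧ T y = τ y) {y : Euc d} (hy : y ∈ closure W) :
    H y = c ∧ T y = τ y := by
  have hy2 : y ∈ closure (Ω₂ : Set (Euc d)) := closure_mono hWs hy
  have hsub : W ⊆ closure (Ω₂ : Set (Euc d)) := hWs.trans subset_closure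
  have hne : (𝓝[W] y).NeBot := mem_closure_iff_nhdsWithin_neBot.1 hy
  have h1 : H y = c := by
    refine tendsto_nhds_unique ((h.continuousOn y hy2).mono hsub) ?_
    refine tendsto_const_nhds.congr' ?_
    filter_upwards [self_mem_nhdsWithin] with z hz using (hW z hz).1.symm
  refine ⟨h1, tendsto_nhds_unique ((h.continuousWithinAt hy2 (h1 ▸ hc)).mono hsub) ?_⟩
  refine (hτ.continuousAt.mono_left nhdsWithin_le_nhds).congr' ?_
  filter_upwards [self_mem_nhdsWithin] with z hz using (hW z hz).2.symm

/-- The rigid motion attached to a component of the set of linked points maps it onto `Ω₁`. -/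
theorem image_component_eq (hd : 1 ≤ d) (hΩ₁ : IsLipschitzDomain Ω₁) (hΩ₂ : IsLipschitzDomain Ω₂)
    (h : IsWeightedComposition Ω₁ Ω₂ U H T) {β : C(frontier (Ω₂ : Set (Euc d)), ℂ)}
    (hβ : ∀ φ : 𝓓(Ω₁, ℂ), U (testFun φ) ∈ robinDomain Ω₂ β)
    {y₀ : Euc d} (hy₀ : y₀ ∈ goodSet Ω₁ Ω₂ H T) {c : ℂ} {τ : Euc d ≃ᵢ Euc d} (hc : c ≠ 0)
    (hτ : ContDiff ℝ ∞ τ.symm)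
    (hW : ∀ y ∈ connectedComponentIn (goodSet Ω₁ Ω₂ H T) y₀, H y = c ∧ T y = τ y) :
    τ '' connectedComponentIn (goodSet Ω₁ Ω₂ H T) y₀ = Ω₁ := by
  set G := goodSet Ω₁ Ω₂ H T with hG
  set W := connectedComponentIn G y₀ with hWdef
  have hGo : IsOpen G := h.isOpen_goodSet
  have hGΩ : G ⊆ Ω₂ := fun x hx => hx.1
  have hWG : W ⊆ G := connectedComponentIn_subset G y₀
  have hWo : IsOpen W := hGo.connectedComponentIn
  have hyW : y₀ ∈ W := mem_connectedComponentIn hy₀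
  have hsub : τ '' W ⊆ Ω₁ := by
    rintro _ ⟨y, hy, rfl⟩
    rw [← (hW y hy).2]
    exact (hWG hy).2.2
  have habs : ∀ {S : Set (Euc d)}, IsPreconnected S → S ⊆ G → (S ∩ W).Nonempty → S ⊆ W := by
    rintro S hS hSG ⟨x, hxS, hxW⟩
    rw [hWdef, connectedComponentIn_eq hxW]
    exact hS.subset_connectedComponentIn hxS hSG
  -- The image is open and nonempty, so by connectedness of `Ω₁` it is enough that it is relatively
  -- closed there.
  refine hsub.antisymm (hΩ₁.isConnected.isPreconnected.subset_of_closure_inter_subset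
    (τ.toHomeomorph.isOpenMap _ hWo) ⟨τ y₀, hsub ⟨y₀, hyW, rfl⟩, y₀, hyW, rfl⟩ ?_)
  rintro x ⟨hx, hxΩ⟩
  have hcl : closure (τ '' W) = τ '' closure W := (τ.toHomeomorph.image_closure W).symm
  rw [hcl] at hx
  obtain ⟨y, hy, rfl⟩ := hx
  refine ⟨y, ?_, rfl⟩
  have hyΩ : y ∈ closure (Ω₂ : Set (Euc d)) := closure_mono (hWG.trans hGΩ) hy
  obtain ⟨hHy, hTy⟩ := h.eq_on_closure τ.continuous hc (hWG.trans hGΩ) hW hy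
  have hHy0 : H y ≠ 0 := hHy ▸ hc
  have hTy1 : T y ∈ Ω₁ := by rw [hTy]; exact hxΩ
  by_cases hy2 : y ∈ Ω₂
  · have hyG : y ∈ G := ⟨hy2, hHy0, hTy1⟩
    exact habs isPreconnected_connectedComponentIn (connectedComponentIn_subset G y)
      (mem_closure_iff_nhds.1 hy _ (hGo.connectedComponentIn.mem_nhds
        (mem_connectedComponentIn hyG))) (mem_connectedComponentIn hyG)
  · exfalso
    have hyf : y ∈ frontier (Ω₂ : Set (Euc d)) := by
      rw [Ω₂.isOpen.frontier_eq]
      exact ⟨hyΩ, hy2⟩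
    obtain ⟨N, hNo, hyN, hNs, hNc⟩ := hΩ₂.hasLipschitzBoundary.exists_isPreconnected_inter hyf
      (h.eventually_mem hyΩ hHy0 hTy1)
    -- The preconnected set `N ∩ Ω₂` consists of good points and meets `W`, so it lies in this
    -- single component: `H` and `T` have one formula on the whole domain side of `y`.
    have hNW : N ∩ Ω₂ ⊆ W := by
      refine habs hNc (fun z hz => hNs hz.1 hz.2) ?_
      obtain ⟨z, hzN, hzW⟩ := mem_closure_iff_nhds.1 hy _ (hNo.mem_nhds hyN)
      exact ⟨z, ⟨hzN, hGΩ (hWG hzW)⟩, hzW⟩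
    obtain ⟨r, hr, hcut⟩ := exists_testFunction_eqOn (Ω := Ω₁) hxΩ
    have hO : N ∩ τ ⁻¹' Metric.ball (τ y) r ∈ 𝓝 y :=
      inter_mem (hNo.mem_nhds hyN)
        (τ.continuous.continuousAt.preimage_mem_nhds (Metric.ball_mem_nhds _ hr))
    refine not_forall_exists_mem_robinDomain hd hΩ₂.hasLipschitzBoundary hyf hO (β := β)
      fun f hf => ?_
    -- Chosen so that applying `U`, which near `y` is composition with `τ` followed by
    -- multiplication by `c`, returns exactly `f`.
    obtain ⟨φ, hφ⟩ := hcut (fun x => c⁻¹ * f (τ.symm x)) (contDiff_const.mul (hf.comp hτ))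
    refine ⟨_, hβ φ, fun z hz => ?_⟩
    have hzτ : τ z ∈ Metric.ball (τ y) r := mem_preimage.1 (mem_of_mem_inter_right hz.1)
    obtain ⟨h1, h2⟩ := hW z (hNW ⟨hz.1.1, hz.2⟩)
    rw [h.apply_testFun φ (subset_closure hz.2), h1, h2, hφ hzτ]
    simp only [τ.symm_apply_apply]
    exact mul_inv_cancel_left₀ hc _

end IsWeightedComposition

/-! ### Counting the components and assembling the result -/

theorem volume_image_isometryEquiv (τ : Euc d ≃ᵢ Euc d) (s : Set (Euc d)) :
    volume (τ '' s) = volume s := by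
  rw [← EuclideanSpace.euclideanHausdorffMeasure_eq_volume d]
  exact τ.isometry.euclideanHausdorffMeasure_image s

end RobinIntertwining

theorem mainTheorem7 (d : ℕ) (hd : 1 ≤ d) (Ω₁ Ω₂ : Opens (Euc d))
    (hΩ₁ : IsLipschitzDomain Ω₁) (hΩ₂ : IsLipschitzDomain Ω₂)
    (U : C(closure (Ω₁ : Set (Euc d)), ℂ) →L[ℂ] C(closure (Ω₂ : Set (Euc d)), ℂ))
    (ha : ∀ f g : C(closure (Ω₁ : Set (Euc d)), ℂ), f * g = 0 → U f * U g = 0)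
    (hb : ∃ β : C(frontier (Ω₂ : Set (Euc d)), ℂ), ∀ φ : 𝓓(Ω₁, ℂ),
      U (testFun φ) ∈ robinDomain Ω₂ β ∧
      HasWeakLaplacian Ω₂ (zeroExt (U (testFun φ))) (zeroExt (U (testLaplacian φ))))
    (hc : ∀ ω : Set (Euc d), IsOpen ω → ω ⊆ Ω₂ →
      (∀ φ : 𝓓(Ω₁, ℂ), ∀ y : closure (Ω₂ : Set (Euc d)), (y : Euc d) ∈ ω → U (testFun φ) y = 0) →
      ω = ∅) :
    ∃ (c : ℂ) (n : ℕ) (ω : Fin n → Set (Euc d)) (τ : Fin n → Euc d ≃ᵢ Euc d),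
      c ≠ 0 ∧ 1 ≤ n ∧
      (∀ i, IsOpen (ω i) ∧ IsConnected (ω i) ∧ ω i ⊆ Ω₂ ∧ τ i '' ω i = Ω₁) ∧
      Pairwise (fun i j => Disjoint (ω i) (ω j)) ∧
      (Ω₂ : Set (Euc d)) ⊆ closure (⋃ i, ω i) ∧
      ∀ i, ∀ y ∈ closure (ω i), ∃ (hy : y ∈ closure (Ω₂ : Set (Euc d)))
        (hτ : τ i y ∈ closure (Ω₁ : Set (Euc d))),
        ∀ f : C(closure (Ω₁ : Set (Euc d)), ℂ), U f ⟨y, hy⟩ = c * f ⟨τ i y, hτ⟩ := by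
  obtain ⟨β, hb⟩ := hb
  obtain ⟨H, T, h⟩ := exists_isWeightedComposition hΩ₁ U ha
  set G := IsWeightedComposition.goodSet Ω₁ Ω₂ H T with hG
  have hGo : IsOpen G := h.isOpen_goodSet
  have hGΩ : G ⊆ Ω₂ := fun x hx => hx.1
  have hdense : (Ω₂ : Set (Euc d)) ⊆ closure G := h.subset_closure_goodSet hc
  let ι := {s : Set (Euc d) // ∃ y ∈ G, s = connectedComponentIn G y}
  have hιo : ∀ i : ι, IsOpen i.1 := by
    rintro ⟨_, y, hy, rfl⟩
    exact hGo.connectedComponentIn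
  have hιc : ∀ i : ι, IsConnected i.1 := by
    rintro ⟨_, y, hy, rfl⟩
    exact isConnected_connectedComponentIn_iff.2 hy
  have hιG : ∀ i : ι, i.1 ⊆ G := by
    rintro ⟨_, y, hy, rfl⟩
    exact connectedComponentIn_subset G y
  have hιd : Pairwise (fun i j : ι => Disjoint i.1 j.1) := by
    rintro ⟨_, y, hy, rfl⟩ ⟨_, z, hz, rfl⟩ hne
    refine Set.disjoint_left.2 fun x hxy hxz => hne (Subtype.ext ?_)
    simp only
    rw [connectedComponentIn_eq hxy, connectedComponentIn_eq hxz]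
  have hex : ∀ i : ι, ∃ (c : ℂ) (τ : Euc d ≃ᵢ Euc d), c ≠ 0 ∧ τ '' i.1 = Ω₁ ∧
      ∀ y ∈ closure i.1, H y = c ∧ T y = τ y := by
    intro i
    obtain ⟨c, τ, hc0, hτs, hW⟩ := h.exists_isometry hd (fun φ => (hb φ).2) (hιo i) (hιc i) (hιG i)
    refine ⟨c, τ, hc0, ?_, fun y hy =>
      h.eq_on_closure τ.continuous hc0 ((hιG i).trans hGΩ) hW hy⟩
    obtain ⟨_, y, hy, rfl⟩ := i
    exact h.image_component_eq hd hΩ₁ hΩ₂ (fun φ => (hb φ).1) hy hc0 hτs hW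
  choose c τ hc0 hτ hcl using hex
  have hvol : ∀ i : ι, volume i.1 = volume (Ω₁ : Set (Euc d)) := fun i => by
    rw [← hτ i, volume_image_isometryEquiv]
  -- Disjoint sets, all of the positive volume of `Ω₁`, inside a set of finite volume.
  have hfin : Finite ι := by
    have h1 := Measure.finite_const_le_meas_of_disjoint_iUnion (volume : Measure (Euc d))
      (Ω₁.isOpen.measure_pos volume hΩ₁.isConnected.nonempty) (As := fun i : ι => i.1)
      (fun i => (hιo i).measurableSet) hιd
      ((measure_mono (iUnion_subset fun i => (hιG i).trans hGΩ)).trans_lt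
        hΩ₂.isBounded.measure_lt_top).ne
    have h2 : {i : ι | volume (Ω₁ : Set (Euc d)) ≤ volume i.1} = univ :=
      eq_univ_of_forall fun i => (hvol i).ge
    rw [h2] at h1
    exact finite_univ_iff.1 h1
  have hunion : (Ω₂ : Set (Euc d)) ⊆ closure (⋃ i : ι, i.1) :=
    hdense.trans (closure_mono fun y hy =>
      mem_iUnion.2 ⟨⟨_, y, hy, rfl⟩, mem_connectedComponentIn hy⟩)
  -- Finiteness is needed here: a finite union of closures is closed.
  have hclu : closure (Ω₂ : Set (Euc d)) ⊆ ⋃ i : ι, closure i.1 := by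
    rw [← closure_iUnion_of_finite]
    exact closure_minimal hunion isClosed_closure
  obtain ⟨x₀, hx₀⟩ := hΩ₂.isConnected.nonempty
  obtain ⟨i₀, -⟩ := mem_iUnion.1 (hclu (subset_closure hx₀))
  -- The weights of the components form a finite, hence discrete, set, so the continuous `H` is
  -- constant on the connected closure of `Ω₂`. This gives one `c` for all components.
  obtain ⟨a, ⟨i₁, rfl⟩, ha'⟩ := hΩ₂.isConnected.isPreconnected.closure.eqOn_const_of_mapsTo
    (finite_range c).isDiscrete h.continuousOn
    (fun y hy => by
      obtain ⟨i, hi⟩ := mem_iUnion.1 (hclu hy)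
      exact ⟨i, ((hcl i y hi).1).symm⟩) ⟨_, i₀, rfl⟩
  obtain ⟨n, ⟨E⟩⟩ := Finite.exists_equiv_fin ι
  refine ⟨c i₁, n, fun k => (E.symm k).1, fun k => τ (E.symm k), hc0 i₁, ?_, fun k =>
    ⟨hιo _, hιc _, (hιG _).trans hGΩ, hτ _⟩, ?_, ?_, ?_⟩
  · exact Nat.one_le_iff_ne_zero.2 fun hn => by
      subst hn
      exact (E i₀).elim0
  · exact fun k l hkl => hιd (E.symm.injective.ne hkl)
  · rw [E.symm.surjective.iUnion_comp (fun i : ι => i.1)]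
    exact hunion
  · intro k y hy
    have hyΩ : y ∈ closure (Ω₂ : Set (Euc d)) := closure_mono ((hιG _).trans hGΩ) hy
    have hTy := (hcl _ y hy).2
    have hτy : τ (E.symm k) y ∈ closure (Ω₁ : Set (Euc d)) := hTy ▸ h.mapsTo hyΩ
    refine ⟨hyΩ, hτy, fun f => ?_⟩
    have h1 := h.apply_eq f y hyΩ
    rw [zeroExt_apply _ hyΩ, hTy, zeroExt_apply _ hτy] at h1
    rw [h1, ha' hyΩ]
    rfl
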